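/- Let $M$ be a smooth manifold of dimension $m$. A \emph{weighting} of $M$ is a filtration $C^\infty_M=C^\infty_{M,(0)}\supseteq C^\infty_{M,(1)}\supseteq\cdots$ of the sheaf of smooth functions with $C^\infty_{M,(i)}C^\infty_{M,(j)}\subseteq C^\infty_{M,(i+j)}$, such that every point has an open neighbourhood $U$ with coordinates $x_1,\dots,x_m$ and a weight vector $(w_1,\dots,w_m)\in\mathbb{Z}_{\ge 0}^m$ for which $C^\infty(U)_{(i)}$ is the ideal generated by the monomials $x_1^{s_1}\cdots x_m^{s_m}$ with $\sum_a w_as_a\geq i$; for $i\le 0$ put $C^\infty_{M,(i)}=C^\infty_M$. Write $\mathfrak{X}(M)_{(i)}$ for the vector fields $X$ such that $f\in C^\infty(M)_{(j)}$ implies $Xf\in C^\infty(M)_{(i+j)}$. Let $A\to M$ be a vector bundle of rank $k$ over a weighted manifold $M$. A \emph{linear weighting} of $A$ is a $\mathbb{Z}$-indexed decreasing filtration $\Gamma_{A,(i)}$ of the sheaf of sections by $C^\infty_M$-submodules such that every point has an open neighbourhood $U$ with a frame $\sigma_1,\dots,\sigma_k$ of $A|_U$ and integers $v_1,\dots,v_k$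 for which $\Gamma(A|_U)_{(i)}=\sum_a C^\infty(U)_{(i-v_a)}\sigma_a$ for all $i$. It induces the following filtrations. 1. $\omega\in\Gamma(\wedge^nA^*)_{(i)}$ if $\omega(\sigma_1,\dots,\sigma_n)\in C^\infty(M)_{(i+j_1+\cdots+j_n)}$ for all $j_1,\dots,j_n\in\mathbb{Z}$ and all $\sigma_l\in\Gamma(A)_{(j_l)}$. 2. For $\sigma\in\Gamma(A)$ let $f_\sigma$ be the corresponding fibrewise linear function on $A^*$, and let $p:A^*\to M$ be the projection. The fibrewise homogeneous polynomial functions of degree $n$ on $A^*$ that are locally finite sums of products $p^*h\cdot f_{\sigma_1}\cdots f_{\sigma_n}$, with $h\in C^\infty_{M,(a)}$, $\sigma_l\in\Gamma_{A,(b_l)}$ local sections and $a+b_1+\cdots+b_n=i$, form $C^\infty_{[n]}(A^*)_{(i)}$, and $C^\infty_{pol}(A^*)_{(i)}=\bigoplus_{n\ge0}C^\infty_{[n]}(A^*)_{(i)}$. Now let $A\Rightarrow M$ be a Lie algebroid with anchor $a:A\to TM$ and bracket $[\cdot,\cdot]$. Let $\pi$ be its linear Poisson bivector field on $A^*$, determined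 by $\pi(\mathrm{d}f_\sigma,\mathrm{d}f_\tau)=f_{[\sigma,\tau]}$, $\pi(\mathrm{d}f_\sigma,\mathrm{d}p^*g)=p^*(a(\sigma)g)$ and $\pi(\mathrm{d}p^*f,\mathrm{d}p^*g)=0$. Let $\mathrm{d}_A$ be its differential on $\Gamma(\wedge A^*)$, given for $\omega\in\Gamma(\wedge^nA^*)$ by $$(\mathrm{d}_A\omega)(\sigma_0,\dots,\sigma_n)=\sum_{i}(-1)^{i}\mathcal{L}_{a(\sigma_i)}\,\omega(\dots,\widehat{\sigma_i},\dots)+\sum_{i<j}(-1)^{i+j}\omega([\sigma_i,\sigma_j],\dots,\widehat{\sigma_i},\dots,\widehat{\sigma_j},\dots).$$ \textbf{Theorem.} Let $A\Rightarrow M$ be a Lie algebroid endowed with a linear weighting. The following are equivalent. (a) The weighting is infinitesimally multiplicative: $a(\Gamma(A)_{(i)})\subseteq\mathfrak{X}(M)_{(i)}$ and $[\Gamma(A)_{(i)},\Gamma(A)_{(j)}]\subseteq\Gamma(A)_{(i+j)}$ for all $i,j\in\mathbb{Z}$. (b) The bivector field $\pi$ has filtration degree zero: $\pi(\mathrm{d}G,\mathrm{d}H)\in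 C^\infty_{pol}(A^*)_{(i+j)}$ for all $i,j\in\mathbb{Z}$, $G\in C^\infty_{pol}(A^*)_{(i)}$ and $H\in C^\infty_{pol}(A^*)_{(j)}$. (c) The differential is filtration preserving: $\mathrm{d}_A(\Gamma(\wedge^n A^*)_{(i)})\subseteq\Gamma(\wedge^{n+1} A^*)_{(i)}$ for all $n\ge 0$ and $i\in\mathbb{Z}$. -/

import Mathlib

open Bundle Set TopologicalSpace Finset
open scoped Manifold ContDiff Topology

set_option linter.unusedSectionVars false

noncomputable section

namespace WLA

section Base

variable {m : ℕ} {M : Type*} [TopologicalSpace M] [ChartedSpace (EuclideanSpace ℝ (Fin m)) M]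

/-- The smooth real functions on `M`. -/
abbrev Fn (m : ℕ) (M : Type*) [TopologicalSpace M]
    [ChartedSpace (EuclideanSpace ℝ (Fin m)) M] : Type _ :=
  C^∞⟮𝓡 m, M; 𝓘(ℝ, ℝ), ℝ⟯

/-- The local model on the domain `U` of a chart `e` with coordinates `x₁, …, xₘ`:
the `i`-th step of the filtration of `C^∞(U)` is the ideal generated by the monomials
`x₁ ^ s₁ ⋯ xₘ ^ sₘ` with `w₁ s₁ + ⋯ + wₘ sₘ ≥ i`.
A function on `U` is represented by any function on `M` that restricts to it. -/
def monomialIdeal (e : OpenPartialHomeomorph M (EuclideanSpace ℝ (Fin m))) (w : Fin m → ℕ)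
    (i : ℤ) : Set (M → ℝ) :=
  {f | ∃ (S : Finset (Fin m → ℕ)) (g : (Fin m → ℕ) → M → ℝ),
    (∀ s ∈ S, i ≤ ∑ a, (w a : ℤ) * (s a : ℤ)) ∧
    (∀ s ∈ S, ContMDiffOn (𝓡 m) 𝓘(ℝ, ℝ) ∞ (g s) e.source) ∧
    ∀ q ∈ e.source, f q = ∑ s ∈ S, g s q * ∏ a, (e q a) ^ (s a)}

/-- A weighting of the manifold `M`: a multiplicative filtration of the sheaf of smooth functions,
given near every point by the local model for some coordinate system and some weight vector.
`Fil i U` is the `i`-th step over the open set `U`; its elements are functions on `U`, represented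
by functions on `M` whose values outside `U` are irrelevant. The filtration is indexed by `ℤ`, all
steps of non-positive degree being the whole sheaf. -/
structure Weighting (m : ℕ) (M : Type*) [TopologicalSpace M]
    [ChartedSpace (EuclideanSpace ℝ (Fin m)) M] where
  Fil : ℤ → Opens M → Submodule ℝ (M → ℝ)
  congr' : ∀ {i} {U : Opens M} {f g}, f ∈ Fil i U → EqOn f g U → g ∈ Fil i U
  smooth : ∀ {i} {U : Opens M} {f}, f ∈ Fil i U → ContMDiffOn (𝓡 m) 𝓘(ℝ, ℝ) ∞ f U
  restrict : ∀ {i} {U U' : Opens M} {f}, f ∈ Fil i U → U' ≤ U → f ∈ Fil i U'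
  glue : ∀ {i} {U : Opens M} {f}, (∀ p ∈ U, ∃ U' : Opens M, p ∈ U' ∧ U' ≤ U ∧ f ∈ Fil i U') → f ∈ Fil i U
  anti : ∀ {i j} {U : Opens M}, i ≤ j → Fil j U ≤ Fil i U
  nonpos : ∀ {i} {U : Opens M} {f}, i ≤ 0 → ContMDiffOn (𝓡 m) 𝓘(ℝ, ℝ) ∞ f U → f ∈ Fil i U
  mul : ∀ {i j} {U : Opens M} {f g}, f ∈ Fil i U → g ∈ Fil j U → f * g ∈ Fil (i + j) U
  exists_coordinates : ∀ p : M, ∃ e ∈ IsManifold.maximalAtlas (𝓡 m) ∞ M, p ∈ e.source ∧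
    ∃ w : Fin m → ℕ, ∀ i f, f ∈ Fil i ⟨e.source, e.open_source⟩ ↔ f ∈ monomialIdeal e w i

/-- The derivative `(X f)(x)` of a function along the tangent vector `X` at `x`. -/
def lieDeriv (f : M → ℝ) (x : M) (X : TangentSpace (𝓡 m) x) : ℝ :=
  mfderiv (𝓡 m) 𝓘(ℝ, ℝ) f x X

/-- The vector fields of filtration degree `i` on the weighted manifold `M`: those smooth vector
fields whose Lie derivative raises filtration degrees by `i`. -/
def Weighting.vectorFields (W : Weighting m M) [IsManifold (𝓡 m) ∞ M] (i : ℤ) :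
    Set (∀ x : M, TangentSpace (𝓡 m) x) :=
  {X | ContMDiff (𝓡 m) (𝓡 m).tangent ∞ (fun x => (⟨x, X x⟩ : TangentBundle (𝓡 m) M)) ∧
    ∀ (j : ℤ) (f : M → ℝ), f ∈ W.Fil j ⊤ → (fun x => lieDeriv f x (X x)) ∈ W.Fil (i + j) ⊤}

end Base

section BundleDefs

variable {m : ℕ} {M : Type*} [TopologicalSpace M] [ChartedSpace (EuclideanSpace ℝ (Fin m)) M]
  (F : Type*) [NormedAddCommGroup F] [NormedSpace ℝ F]
  (A : M → Type*) [TopologicalSpace (TotalSpace F A)] [∀ x, AddCommGroup (A x)]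
  [∀ x, Module ℝ (A x)] [∀ x, TopologicalSpace (A x)] [FiberBundle F A] [VectorBundle ℝ F A]

/-- A linear weighting of the vector bundle `A` over the weighted manifold `M`: a filtration of the
sheaf of sections by `C^∞`-submodules such that near every point there are a frame `σ₁, …, σₖ` and
vertical weights `v₁, …, vₖ` for which the `i`-th step is `∑ C^∞_{(i - vₐ)} σₐ`. As for functions,
a section over `U` is represented by a family of vectors over `M`. -/
structure LinearWeighting (W : Weighting m M) where
  Fil : ℤ → Opens M → Submodule ℝ (∀ x, A x)
  congr' : ∀ {i} {U : Opens M} {σ τ}, σ ∈ Fil i U → (∀ x ∈ U, σ x = τ x) → τ ∈ Fil i U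
  smooth : ∀ {i} {U : Opens M} {σ}, σ ∈ Fil i U →
    ContMDiffOn (𝓡 m) ((𝓡 m).prod 𝓘(ℝ, F)) ∞ (fun x => TotalSpace.mk' F x (σ x)) U
  restrict : ∀ {i} {U U' : Opens M} {σ}, σ ∈ Fil i U → U' ≤ U → σ ∈ Fil i U'
  glue : ∀ {i} {U : Opens M} {σ}, (∀ p ∈ U, ∃ U' : Opens M, p ∈ U' ∧ U' ≤ U ∧ σ ∈ Fil i U') → σ ∈ Fil i U
  anti : ∀ {i j} {U : Opens M}, i ≤ j → Fil j U ≤ Fil i U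
  smul : ∀ {i} {U : Opens M} {f : M → ℝ} {σ}, ContMDiffOn (𝓡 m) 𝓘(ℝ, ℝ) ∞ f U → σ ∈ Fil i U →
    (fun x => f x • σ x) ∈ Fil i U
  exists_frame : ∀ p : M, ∃ U : Opens M, p ∈ U ∧
    ∃ (σ : Fin (Module.finrank ℝ F) → ∀ x, A x) (v : Fin (Module.finrank ℝ F) → ℤ),
      IsLocalFrameOn (𝓡 m) F ∞ σ U ∧
      ∀ i τ, τ ∈ Fil i U ↔ ∃ f : Fin (Module.finrank ℝ F) → M → ℝ,
        (∀ a, f a ∈ W.Fil (i - v a) U) ∧ ∀ x ∈ U, τ x = ∑ a, f a x • σ a x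

/-- The smooth global sections of `A`. -/
abbrev Sec (m : ℕ) {M : Type*} [TopologicalSpace M]
    [ChartedSpace (EuclideanSpace ℝ (Fin m)) M] (F : Type*) [NormedAddCommGroup F]
    [NormedSpace ℝ F] (A : M → Type*) [TopologicalSpace (TotalSpace F A)]
    [∀ x, TopologicalSpace (A x)] [FiberBundle F A] : Type _ :=
  Cₛ^∞⟮𝓡 m; F, A⟯

variable {F A}

/-- The product of a smooth function and a smooth section. -/
def fsmul (f : Fn m M) (σ : Sec m F A) : Sec m F A :=
  ⟨fun x => f x • σ x, f.contMDiff.smul_section σ.contMDiff⟩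

variable (m F A) in
/-- A Lie algebroid structure on the vector bundle `A` over `M`. -/
structure LieAlgebroid [IsManifold (𝓡 m) ∞ M] where
  bracket : Sec m F A →ₗ[ℝ] Sec m F A →ₗ[ℝ] Sec m F A
  anchor : ∀ x, A x →ₗ[ℝ] TangentSpace (𝓡 m) x
  anchor_smooth : ContMDiff ((𝓡 m).prod 𝓘(ℝ, F)) (𝓡 m).tangent ∞
    (fun v : TotalSpace F A => (⟨v.1, anchor v.1 v.2⟩ : TangentBundle (𝓡 m) M))
  bracket_self : ∀ σ, bracket σ σ = 0
  jacobi : ∀ σ τ ρ,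
    bracket σ (bracket τ ρ) = bracket (bracket σ τ) ρ + bracket τ (bracket σ ρ)
  leibniz : ∀ (σ τ : Sec m F A) (f : Fn m M) (x : M),
    bracket σ (fsmul f τ) x = f x • bracket σ τ x + lieDeriv f x (anchor x (σ x)) • τ x

variable [IsManifold (𝓡 m) ∞ M]

/-- The weighting is infinitesimally multiplicative: anchor and bracket are compatible with the
filtrations. -/
def IsInfMultiplicative (𝔸 : LieAlgebroid m F A) {W : Weighting m M}
    (L : LinearWeighting F A W) : Prop :=
  (∀ (i : ℤ) (σ : Sec m F A), ⇑σ ∈ L.Fil i ⊤ →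
    (fun x => 𝔸.anchor x (σ x)) ∈ W.vectorFields i) ∧
  ∀ (i j : ℤ) (σ τ : Sec m F A), ⇑σ ∈ L.Fil i ⊤ → ⇑τ ∈ L.Fil j ⊤ →
    ⇑(𝔸.bracket σ τ) ∈ L.Fil (i + j) ⊤

/-! ### The differential on `Γ(∧ A*)` -/

variable (m F A) in
/-- A smooth section of `∧ᵏ A*`: a family of alternating `k`-forms on the fibres whose values on
smooth sections are smooth functions. -/
structure Form (k : ℕ) where
  toFun : ∀ x, A x [⋀^Fin k]→ₗ[ℝ] ℝ
  smooth : ∀ s : Fin k → Sec m F A,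
    ContMDiff (𝓡 m) 𝓘(ℝ, ℝ) ∞ (fun x => toFun x (fun l => s l x))

/-- The function `η(σ₁, …, σₖ)`. -/
def Form.eval {k : ℕ} (η : Form m F A k) (s : Fin k → Sec m F A) : M → ℝ :=
  fun x => η.toFun x (fun l => s l x)

/-- The terms `∑_{i<j} (-1)^{i+j} η([σᵢ, σⱼ], σ₀, …, σ̂ᵢ, …, σ̂ⱼ, …, σₖ)` of the differential.
For `i < j` the inner index below is an element of `Fin (n + 1)`, and removing first the `j`-th
entry of the list and then the `i`-th one leaves the entries other than `i` and `j`. -/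
def bracketTerms (𝔸 : LieAlgebroid m F A) :
    {k : ℕ} → Form m F A k → (Fin (k + 1) → Sec m F A) → M → ℝ
  | 0, _, _ => 0
  | n + 1, η, s => fun x =>
    ∑ j : Fin (n + 2), ∑ i : Fin (n + 1),
      if i.castSucc < j then
        (-1 : ℝ) ^ ((i : ℕ) + (j : ℕ)) *
          η.eval (Fin.cons (𝔸.bracket (s i.castSucc) (s j))
            (fun l : Fin n => s (j.succAbove (i.succAbove l)))) x
      else 0

/-- The Lie algebroid differential `d_A η` of `η ∈ Γ(∧ᵏ A*)`, a section of `∧ᵏ⁺¹ A*` given by its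
values `(d_A η)(σ₀, …, σₖ)` on sections. -/
def dA (𝔸 : LieAlgebroid m F A) {k : ℕ} (η : Form m F A k) (s : Fin (k + 1) → Sec m F A) :
    M → ℝ :=
  fun x => bracketTerms 𝔸 η s x +
    ∑ i : Fin (k + 1), (-1 : ℝ) ^ (i : ℕ) *
      lieDeriv (η.eval (fun l => s (i.succAbove l))) x (𝔸.anchor x (s i x))

/-- The weighting of `∧ᵏ A* = (∧ᵏ A)*` dual to that of `∧ᵏ A`: a form, given by its values on
sections, has filtration degree `i` if its value on sections of degrees `j₁, …, jₖ` is a function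
of degree `i + j₁ + ⋯ + jₖ`. -/
def FormFil {W : Weighting m M} (L : LinearWeighting F A W) (k : ℕ) (i : ℤ) :
    Set ((Fin k → Sec m F A) → M → ℝ) :=
  {Φ | ∀ (j : Fin k → ℤ) (s : Fin k → Sec m F A), (∀ l, ⇑(s l) ∈ L.Fil (j l) ⊤) →
    Φ s ∈ W.Fil (i + ∑ l, j l) ⊤}

/-- `d_A : Γ(∧ A*) → Γ(∧ A*)` is filtration preserving. -/
def DifferentialPreservesFiltration (𝔸 : LieAlgebroid m F A) {W : Weighting m M}
    (L : LinearWeighting F A W) : Prop :=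
  ∀ (k : ℕ) (i : ℤ) (η : Form m F A k), η.eval ∈ FormFil L k i → dA 𝔸 η ∈ FormFil L (k + 1) i

/-! ### The linear Poisson structure on `A*` -/

variable (F A) in
/-- The total space of the dual bundle `A*`. -/
abbrev DualSpace : Type _ :=
  TotalSpace (F →L[ℝ] ℝ) (fun x => A x →L[ℝ] Bundle.Trivial M ℝ x)

/-- The function `f_σ + p^* f` on `A*`, where `f_σ` is the fibrewise linear function defined by the
section `σ` and `p : A* → M` is the projection. -/
def affineFn (σ : Sec m F A) (f : Fn m M) : DualSpace F A → ℝ :=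
  fun ξ => ξ.2 (σ ξ.1) + f ξ.1

variable (m) in
/-- Covectors on the manifold `A*`. -/
abbrev DualCovector (ξ : DualSpace F A) : Type _ :=
  TangentSpace ((𝓡 m).prod 𝓘(ℝ, F →L[ℝ] ℝ)) ξ →L[ℝ] ℝ

variable (m) in
/-- The differential at `ξ ∈ A*` of a function on `A*`. -/
def dDual (G : DualSpace F A → ℝ) (ξ : DualSpace F A) : DualCovector m ξ :=
  mfderiv ((𝓡 m).prod 𝓘(ℝ, F →L[ℝ] ℝ)) 𝓘(ℝ, ℝ) G ξ

/-- The value at `ξ` of the Lie-Poisson bracket of `f_σ + p^* f` and `f_τ + p^* g`, that is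
`⟨ξ, [σ, τ]⟩ + a(σ) g - a(τ) f`. -/
def affineBracket (𝔸 : LieAlgebroid m F A) (ξ : DualSpace F A)
    (σ : Sec m F A) (f : Fn m M) (τ : Sec m F A) (g : Fn m M) : ℝ :=
  (ξ.2 (𝔸.bracket σ τ ξ.1) : ℝ) + lieDeriv g ξ.1 (𝔸.anchor ξ.1 (σ ξ.1))
    - lieDeriv f ξ.1 (𝔸.anchor ξ.1 (τ ξ.1))

open Classical in
/-- The linear Poisson bivector field `π` on `A*`, as a form on the covectors at each point `ξ`.
It is determined by the linear Poisson structure `{f_σ, f_τ} = f_{[σ, τ]}`,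
`{f_σ, p^* f} = p^* (a(σ) f)`, `{p^* f, p^* g} = 0`: every covector at `ξ` is the differential of
some `f_σ + p^* f`, and the value of `π` on two such differentials is that of the bracket.
The result does not depend on the choice of the representing functions, by `poisson_apply`. -/
def poisson (𝔸 : LieAlgebroid m F A) (ξ : DualSpace F A) (α β : DualCovector m ξ) : ℝ :=
  if h : ∃ r : (Sec m F A × Fn m M) × (Sec m F A × Fn m M),
      α = dDual m (affineFn r.1.1 r.1.2) ξ ∧ β = dDual m (affineFn r.2.1 r.2.2) ξ then
    affineBracket 𝔸 ξ h.choose.1.1 h.choose.1.2 h.choose.2.1 h.choose.2.2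
  else 0

/-! ### Polynomial functions on `A*` -/

/-- The products `p^* h · f_{σ₁} ⋯ f_{σₙ}` over the open set `U`, where `h` is a function on `U` and
`σ₁, …, σₙ` are sections over `U` whose filtration degrees add up to `i`. -/
def monomials {W : Weighting m M} (L : LinearWeighting F A W) (n : ℕ) (i : ℤ) (U : Opens M) :
    Set (DualSpace F A → ℝ) :=
  {G | ∃ (h : M → ℝ) (σ : Fin n → ∀ x, A x) (a : ℤ) (b : Fin n → ℤ),
    h ∈ W.Fil a U ∧ (∀ l, σ l ∈ L.Fil (b l) U) ∧ a + ∑ l, b l = i ∧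
    G = fun ξ => h ξ.1 * ∏ l, (ξ.2 (σ l ξ.1) : ℝ)}

/-- The filtration of the fibrewise homogeneous polynomial functions of degree `n` on `A*`: the
weighting of `Symⁿ A`, `Γ(Symⁿ A)` being identified with these functions. -/
def homPoly {W : Weighting m M} (L : LinearWeighting F A W) (n : ℕ) (i : ℤ) :
    Set (DualSpace F A → ℝ) :=
  {G | ∀ p : M, ∃ U : Opens M, p ∈ U ∧
    ∃ P ∈ Submodule.span ℝ (monomials L n i U), ∀ ξ : DualSpace F A, ξ.1 ∈ U → G ξ = P ξ}

/-- The filtration of the fibrewise polynomial functions on `A*`: the direct sum over `n` of the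
filtrations of the homogeneous ones. -/
def polyFn {W : Weighting m M} (L : LinearWeighting F A W) (i : ℤ) : Set (DualSpace F A → ℝ) :=
  {G | ∃ (d : ℕ) (g : ℕ → DualSpace F A → ℝ), (∀ n, g n ∈ homPoly L n i) ∧
    G = ∑ n ∈ Finset.range d, g n}

/-- The bivector fields `B` on `A*` of filtration degree `q`: the bracket `B(dG, dH)` of polynomial
functions of degrees `i` and `j` has degree `q + i + j`. -/
def bivectors {W : Weighting m M} (L : LinearWeighting F A W) (q : ℤ) :
    Set (∀ ξ : DualSpace F A, DualCovector m ξ → DualCovector m ξ → ℝ) :=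
  {B | ∀ (i j : ℤ) (G H : DualSpace F A → ℝ), G ∈ polyFn L i → H ∈ polyFn L j →
    (fun ξ => B ξ (dDual m G ξ) (dDual m H ξ)) ∈ polyFn L (q + i + j)}

end BundleDefs

section PoissonWellDefined

variable {m : ℕ} {M : Type*} [TopologicalSpace M] [ChartedSpace (EuclideanSpace ℝ (Fin m)) M]
  [IsManifold (𝓡 m) ∞ M] [T2Space M]
  {F : Type*} [NormedAddCommGroup F] [NormedSpace ℝ F] [FiniteDimensional ℝ F]
  {A : M → Type*} [TopologicalSpace (TotalSpace F A)] [∀ x, AddCommGroup (A x)]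
  [∀ x, Module ℝ (A x)] [∀ x, TopologicalSpace (A x)] [FiberBundle F A] [VectorBundle ℝ F A]
  [ContMDiffVectorBundle ∞ F A (𝓡 m)]

theorem eq_zero_of_tensorial (Φ : Sec m F A →ₗ[ℝ] ℝ) (p : M)
    (h : ∀ (f : Fn m M) (σ : Sec m F A), Φ (fsmul f σ) = f p * Φ σ)
    (σ : Sec m F A) (hσ : σ p = 0) : Φ σ = 0 := by
  classical
  have : ContMDiffVectorBundle 1 F A (𝓡 m) := ContMDiffVectorBundle.of_le (n := ∞) (by simp)
  let t := trivializationAt F A p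
  have hp : p ∈ t.baseSet := FiberBundle.mem_baseSet_trivializationAt F A p
  let b := Module.finBasis ℝ F
  obtain ⟨ψ, -, hψ⟩ := (SmoothBumpFunction.nhds_basis_tsupport (I := 𝓡 m) p).mem_iff.1
    (t.open_baseSet.mem_nhds hp)
  have hψs : ContMDiff (𝓡 m) 𝓘(ℝ, ℝ) ∞ ψ := ψ.contMDiff
  let Ψ : Fn m M := ⟨ψ, hψs⟩
  let E : Fin (Module.finrank ℝ F) → Sec m F A := fun k =>
    ⟨(ψ : M → ℝ) • t.localFrame b k, ContMDiffOn.smul_section_of_tsupport hψs.contMDiffOn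
      t.open_baseSet hψ (t.contMDiffOn_localFrame_baseSet ∞ b k)⟩
  let c := t.localFrameCoeff (𝓡 m) b
  have hc : ∀ k, ContMDiffOn (𝓡 m) 𝓘(ℝ, ℝ) ∞ (fun x => c k x (σ x)) t.baseSet := fun k =>
    contMDiffOn_baseSet_localFrameCoeff b (s := σ) σ.contMDiff.contMDiffOn k
  let hh : Fin (Module.finrank ℝ F) → Fn m M := fun k =>
    ⟨fun x => ψ x * c k x (σ x), by
      refine contMDiff_of_tsupport fun x hx => ?_
      have hx' : x ∈ t.baseSet := hψ (tsupport_mul_subset_left hx)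
      exact (hψs x).mul ((hc k).contMDiffAt (t.open_baseSet.mem_nhds hx'))⟩
  have key : fsmul Ψ (fsmul Ψ σ) = ∑ k, fsmul (hh k) (E k) := by
    ext x
    have e1 : (∑ k, fsmul (hh k) (E k)) x = ∑ k, (fsmul (hh k) (E k)) x := by
      induction (Finset.univ : Finset (Fin (Module.finrank ℝ F))) using Finset.induction_on with
      | empty => simp
      | insert a s ha ih => rw [Finset.sum_insert ha, Finset.sum_insert ha, ← ih]; rfl
    rw [e1]
    by_cases hx : x ∈ t.baseSet
    · change ψ x • ψ x • σ x = ∑ k, (ψ x * c k x (σ x)) • ψ x • t.localFrame b k x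
      conv_lhs => rw [t.eq_sum_localFrameCoeff_smul (I := 𝓡 m) (b := b) (s := σ) hx]
      simp only [Finset.smul_sum]
      refine Finset.sum_congr rfl fun k _ => ?_
      simp only [smul_smul]
      congr 1
      ring
    · have h0 : ψ x = 0 := image_eq_zero_of_notMem_tsupport fun h => hx (hψ h)
      change ψ x • ψ x • σ x = ∑ k, (ψ x * c k x (σ x)) • ψ x • t.localFrame b k x
      simp [h0]
  have h1 := congrArg Φ key
  rw [h, h, map_sum] at h1
  have hψ1 : Ψ p = 1 := ψ.eq_one
  rw [hψ1] at h1
  simp only [h] at h1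
  have h2 : ∀ k, hh k p = 0 := fun k => by
    change ψ p * c k p (σ p) = 0
    rw [hσ]; simp
  simpa [h2] using h1

theorem lieDeriv_add {f g : M → ℝ} {x : M} (hf : MDifferentiableAt (𝓡 m) 𝓘(ℝ, ℝ) f x)
    (hg : MDifferentiableAt (𝓡 m) 𝓘(ℝ, ℝ) g x) (X : TangentSpace (𝓡 m) x) :
    lieDeriv (fun y => f y + g y) x X = lieDeriv f x X + lieDeriv g x X :=
  congrArg (fun L : TangentSpace (𝓡 m) x →L[ℝ] ℝ => L X) (mfderiv_add hf hg)

theorem lieDeriv_mul {f g : M → ℝ} {x : M} (hf : MDifferentiableAt (𝓡 m) 𝓘(ℝ, ℝ) f x)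
    (hg : MDifferentiableAt (𝓡 m) 𝓘(ℝ, ℝ) g x) (X : TangentSpace (𝓡 m) x) :
    lieDeriv (fun y => f y * g y) x X = f x * lieDeriv g x X + g x * lieDeriv f x X :=
  congrArg (fun L : TangentSpace (𝓡 m) x →L[ℝ] ℝ => L X)
    (hf.hasMFDerivAt.mul hg.hasMFDerivAt).mfderiv

theorem lieDeriv_const_mul (c : ℝ) {g : M → ℝ} {x : M}
    (hg : MDifferentiableAt (𝓡 m) 𝓘(ℝ, ℝ) g x) (X : TangentSpace (𝓡 m) x) :
    lieDeriv (fun y => c * g y) x X = c * lieDeriv g x X := by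
  have h0 : lieDeriv (fun _ : M => c) x X = 0 := by
    unfold lieDeriv; rw [mfderiv_const]; rfl
  have := lieDeriv_mul (f := fun _ : M => c) mdifferentiableAt_const hg X
  rw [this, h0]; ring

theorem fn_mdiff (f : Fn m M) (x : M) : MDifferentiableAt (𝓡 m) 𝓘(ℝ, ℝ) f x :=
  f.contMDiff.mdifferentiableAt (by simp)

theorem contMDiff_affineFn (σ : Sec m F A) (f : Fn m M) :
    ContMDiff ((𝓡 m).prod 𝓘(ℝ, F →L[ℝ] ℝ)) 𝓘(ℝ, ℝ) ∞ (affineFn (F := F) σ f) := by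
  have hproj : ContMDiff ((𝓡 m).prod 𝓘(ℝ, F →L[ℝ] ℝ)) (𝓡 m) ∞
      (fun ξ : DualSpace F A => ξ.1) := contMDiff_proj _
  refine ContMDiff.add ?_ (f.contMDiff.comp hproj)
  have h := ContMDiff.clm_bundle_apply (IB := 𝓡 m) (n := ∞) (F₂ := ℝ) (E₂ := Bundle.Trivial M ℝ)
    (b := fun ξ : DualSpace F A => ξ.1) (ϕ := fun ξ => ξ.2) (v := fun ξ => σ ξ.1)
    contMDiff_id (σ.contMDiff.comp hproj)
  intro ξ
  exact (contMDiffAt_totalSpace.1 (h ξ)).2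

/-- The directional derivative of an affine function along a local section of `A*`. -/
theorem comp_section (σ : Sec m F A) (f : Fn m M) (p : M)
    (s : ∀ x, A x →L[ℝ] Bundle.Trivial M ℝ x)
    (hs : ContMDiffAt (𝓡 m) ((𝓡 m).prod 𝓘(ℝ, F →L[ℝ] ℝ)) ∞
      (fun x => (TotalSpace.mk' (F →L[ℝ] ℝ) x (s x) : DualSpace F A)) p)
    (h : dDual m (affineFn σ f) (⟨p, s p⟩ : DualSpace F A) = 0) :
    mfderiv (𝓡 m) 𝓘(ℝ, ℝ) (fun x => (s x (σ x) + f x : ℝ)) p = 0 := by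
  have := mfderiv_comp (I := 𝓡 m) (I' := (𝓡 m).prod 𝓘(ℝ, F →L[ℝ] ℝ)) (I'' := 𝓘(ℝ, ℝ)) p
    (g := affineFn σ f) (f := fun x => (TotalSpace.mk' (F →L[ℝ] ℝ) x (s x) : DualSpace F A))
    ((contMDiff_affineFn σ f).mdifferentiableAt (by simp)) (hs.mdifferentiableAt (by simp))
  change mfderiv (𝓡 m) 𝓘(ℝ, ℝ) (affineFn σ f ∘
    fun x => (TotalSpace.mk' (F →L[ℝ] ℝ) x (s x) : DualSpace F A)) p = 0
  rw [this]
  unfold dDual at h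
  erw [h]
  rfl

theorem section_eq_zero (σ : Sec m F A) (f : Fn m M) (p : M)
    (ξ : A p →L[ℝ] Bundle.Trivial M ℝ p)
    (h : dDual m (affineFn σ f) (⟨p, ξ⟩ : DualSpace F A) = 0) : σ p = 0 := by
  have vert : ∀ η : A p →L[ℝ] Bundle.Trivial M ℝ p, (η (σ p) : ℝ) = 0 := by
    intro η
    let γ : ℝ → DualSpace F A := fun t => ⟨p, ξ + t • η⟩
    have hγ : ContMDiff 𝓘(ℝ, ℝ) ((𝓡 m).prod 𝓘(ℝ, F →L[ℝ] ℝ)) ∞ γ := by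
      intro t
      refine contMDiffAt_totalSpace.2 ⟨contMDiffAt_const, ?_⟩
      let e := trivializationAt (F →L[ℝ] ℝ) (fun x => A x →L[ℝ] Bundle.Trivial M ℝ x) p
      have hp : p ∈ e.baseSet := FiberBundle.mem_baseSet_trivializationAt _ _ p
      have he : (fun t => (e (γ t)).2) =
          fun t => e.linearMapAt ℝ p ξ + t • e.linearMapAt ℝ p η := by
        funext t
        rw [← map_smul, ← map_add, e.coe_linearMapAt_of_mem hp]
      change ContMDiffAt 𝓘(ℝ, ℝ) 𝓘(ℝ, F →L[ℝ] ℝ) ∞ (fun t => (e (γ t)).2) t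
      rw [he, contMDiffAt_iff_contDiffAt]
      fun_prop
    have h0 : γ 0 = ⟨p, ξ⟩ := by simp [γ]
    have := mfderiv_comp (I := 𝓘(ℝ, ℝ)) (I' := (𝓡 m).prod 𝓘(ℝ, F →L[ℝ] ℝ)) (I'' := 𝓘(ℝ, ℝ))
      (0 : ℝ) (g := affineFn σ f) (f := γ)
      ((contMDiff_affineFn σ f).mdifferentiableAt (by simp)) (hγ.mdifferentiableAt (by simp))
    unfold dDual at h
    rw [← h0] at h
    erw [h] at this
    rw [mfderiv_eq_fderiv] at this
    have e1 : affineFn σ f ∘ γ = fun t : ℝ => (ξ (σ p) + f p : ℝ) + t * (η (σ p) : ℝ) := by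
      funext t
      change ((ξ + t • η) (σ p) : ℝ) + f p = _
      change (ξ (σ p) : ℝ) + t * (η (σ p) : ℝ) + f p = _
      ring
    have e2 : HasDerivAt (affineFn σ f ∘ γ) (η (σ p) : ℝ) (0 : ℝ) := by
      rw [e1]
      simpa using ((hasDerivAt_id (0 : ℝ)).mul_const (η (σ p) : ℝ)).const_add (ξ (σ p) + f p : ℝ)
    have e3 := e2.hasFDerivAt.fderiv
    rw [this] at e3
    have e4 := congrArg (fun L : ℝ →L[ℝ] ℝ => L 1) e3
    have e5 : (ContinuousLinearMap.comp (0 : _ →L[ℝ] ℝ) (mfderiv 𝓘(ℝ, ℝ) ((𝓡 m).prod 𝓘(ℝ, F →L[ℝ] ℝ)) γ 0)) (1 : ℝ) = 0 := rfl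
    have e6 : ((ContinuousLinearMap.toSpanSingleton ℝ (η (σ p) : ℝ)) (1 : ℝ) : ℝ) = (η (σ p) : ℝ) := by
      rw [ContinuousLinearMap.toSpanSingleton_apply]; exact one_mul _
    exact e6.symm.trans (e4.symm.trans e5)
  let e := VectorBundle.continuousLinearEquivAt ℝ F A p
  have : e (σ p) = 0 := by
    refine (SeparatingDual.eq_zero_iff_forall_dual_eq_zero (R := ℝ) _).2 fun φ => ?_
    exact vert (φ.comp (e : A p →L[ℝ] F))
  simpa using this

theorem affineBracket_eq_zero (𝔸 : LieAlgebroid m F A) (ξ : DualSpace F A) (σ τ : Sec m F A)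
    (f g : Fn m M) (h : dDual m (affineFn σ f) ξ = 0) : affineBracket 𝔸 ξ σ f τ g = 0 := by
  obtain ⟨p, ξ⟩ := ξ
  have hσ := section_eq_zero σ f p ξ h
  let s : ∀ x, A x →L[ℝ] Bundle.Trivial M ℝ x := FiberBundle.extend (F →L[ℝ] ℝ) ξ
  have hs : ContMDiffAt (𝓡 m) ((𝓡 m).prod 𝓘(ℝ, F →L[ℝ] ℝ)) ∞
      (fun x => (TotalSpace.mk' (F →L[ℝ] ℝ) x (s x) : DualSpace F A)) p :=
    FiberBundle.contMDiffAt_extend (V := fun x => A x →L[ℝ] Bundle.Trivial M ℝ x) (𝓡 m)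
      (F →L[ℝ] ℝ) ξ
  have hsp : s p = ξ := by simp [s]
  have hd (ρ : Sec m F A) :
      MDifferentiableAt (𝓡 m) 𝓘(ℝ, ℝ) (fun x => (s x (ρ x) : ℝ)) p := by
    have h := ContMDiffAt.clm_bundle_apply (IB := 𝓡 m) (n := ∞) (F₂ := ℝ)
      (E₂ := Bundle.Trivial M ℝ) (b := fun x : M => x) (ϕ := s) (v := fun x => ρ x)
      hs (ρ.contMDiff p)
    exact (contMDiffAt_totalSpace.1 h).2.mdifferentiableAt (by simp)
  rw [← hsp] at h
  have h1 := comp_section σ f p s hs h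
  have h2 (X : TangentSpace (𝓡 m) p) :
      lieDeriv (fun x => (s x (σ x) : ℝ)) p X + lieDeriv f p X = 0 := by
    have := lieDeriv_add (hd σ) (fn_mdiff f p) X
    rw [← this]
    exact congrArg (fun L : TangentSpace (𝓡 m) p →L[ℝ] ℝ => L X) h1
  set X : TangentSpace (𝓡 m) p := 𝔸.anchor p (τ p) with hX
  let Φ : Sec m F A →ₗ[ℝ] ℝ :=
    { toFun := fun ρ => (ξ (𝔸.bracket τ ρ p) : ℝ) - lieDeriv (fun x => (s x (ρ x) : ℝ)) p X
      map_add' := fun ρ ρ' => by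
        have e1 : (𝔸.bracket τ (ρ + ρ')) p = 𝔸.bracket τ ρ p + 𝔸.bracket τ ρ' p := by
          rw [map_add]; rfl
        have e2 : lieDeriv (fun x => (s x ((ρ + ρ') x) : ℝ)) p X =
            lieDeriv (fun x => (s x (ρ x) : ℝ)) p X
              + lieDeriv (fun x => (s x (ρ' x) : ℝ)) p X := by
          rw [← lieDeriv_add (hd ρ) (hd ρ')]
          congr 1
          funext x
          exact map_add (s x) _ _
        rw [e1, e2, map_add]
        change ((ξ _ : ℝ) + (ξ _ : ℝ)) - _ = _
        ring
      map_smul' := fun c ρ => by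
        have e1 : (𝔸.bracket τ (c • ρ)) p = c • 𝔸.bracket τ ρ p := by
          rw [map_smul]; rfl
        have e2 : lieDeriv (fun x => (s x ((c • ρ) x) : ℝ)) p X =
            c * lieDeriv (fun x => (s x (ρ x) : ℝ)) p X := by
          rw [← lieDeriv_const_mul c (hd ρ)]
          congr 1
          funext x
          exact map_smul (s x) _ _
        rw [e1, e2, map_smul]
        change c * (ξ _ : ℝ) - _ = c * (_ - _)
        ring }
  have hΦ : Φ σ = 0 := by
    refine eq_zero_of_tensorial Φ p (fun u ρ => ?_) σ hσ
    change (ξ (𝔸.bracket τ (fsmul u ρ) p) : ℝ)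
        - lieDeriv (fun x => (s x (u x • ρ x) : ℝ)) p X
      = u p * ((ξ (𝔸.bracket τ ρ p) : ℝ) - lieDeriv (fun x => (s x (ρ x) : ℝ)) p X)
    have e2 : lieDeriv (fun x => (s x (u x • ρ x) : ℝ)) p X =
        u p * lieDeriv (fun x => (s x (ρ x) : ℝ)) p X + (s p (ρ p) : ℝ) * lieDeriv u p X := by
      rw [← lieDeriv_mul (fn_mdiff u p) (hd ρ)]
      congr 1
      funext x
      exact map_smul (s x) _ _
    rw [e2, 𝔸.leibniz, map_add, map_smul, map_smul, hsp]
    change (u p * (ξ _ : ℝ) + _ * (ξ _ : ℝ)) - _ = _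
    ring
  have hskew : 𝔸.bracket σ τ = - 𝔸.bracket τ σ := by
    have := 𝔸.bracket_self (σ + τ)
    simp only [map_add, LinearMap.add_apply, 𝔸.bracket_self, zero_add, add_zero] at this
    rw [eq_neg_iff_add_eq_zero, ← this, add_comm]
  have hΦ' : (ξ (𝔸.bracket τ σ p) : ℝ) + lieDeriv f p X = 0 := by
    have := h2 X
    have h3 : (ξ (𝔸.bracket τ σ p) : ℝ) - lieDeriv (fun x => (s x (σ x) : ℝ)) p X = 0 := hΦ
    linarith
  change (ξ (𝔸.bracket σ τ p) : ℝ) + lieDeriv g p (𝔸.anchor p (σ p)) - lieDeriv f p X = 0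
  have e5 : (𝔸.bracket σ τ) p = - 𝔸.bracket τ σ p := by rw [hskew]; rfl
  rw [e5, hσ, map_zero, map_neg]
  have e6 : lieDeriv g p (0 : TangentSpace (𝓡 m) p) = 0 := map_zero (mfderiv (𝓡 m) 𝓘(ℝ, ℝ) g p)
  rw [e6]
  change - (ξ _ : ℝ) + 0 - _ = 0
  linarith

theorem dDual_sub (σ σ' : Sec m F A) (f f' : Fn m M) (ξ : DualSpace F A)
    (h : dDual m (affineFn σ f) ξ = dDual m (affineFn σ' f') ξ) :
    dDual m (affineFn (σ - σ') (f - f')) ξ = 0 := by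
  have e : (affineFn (σ - σ') (f - f') : DualSpace F A → ℝ) = affineFn σ f - affineFn σ' f' := by
    funext η
    have : (η.2 ((σ - σ') η.1) : ℝ) = (η.2 (σ η.1) : ℝ) - (η.2 (σ' η.1) : ℝ) := map_sub η.2 _ _
    change (η.2 ((σ - σ') η.1) : ℝ) + (f η.1 - f' η.1)
      = ((η.2 (σ η.1) : ℝ) + f η.1) - ((η.2 (σ' η.1) : ℝ) + f' η.1)
    rw [this]; ring
  have hs := mfderiv_sub ((contMDiff_affineFn σ f ξ).mdifferentiableAt (by simp))
    ((contMDiff_affineFn σ' f' ξ).mdifferentiableAt (by simp))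
  unfold dDual at *
  rw [e]
  refine hs.trans ?_
  exact sub_eq_zero.2 h

theorem affineBracket_skew (𝔸 : LieAlgebroid m F A) (ξ : DualSpace F A) (σ τ : Sec m F A)
    (f g : Fn m M) : affineBracket 𝔸 ξ σ f τ g = - affineBracket 𝔸 ξ τ g σ f := by
  have hskew : 𝔸.bracket σ τ = - 𝔸.bracket τ σ := by
    have := 𝔸.bracket_self (σ + τ)
    simp only [map_add, LinearMap.add_apply, 𝔸.bracket_self, zero_add, add_zero] at this
    rw [eq_neg_iff_add_eq_zero, ← this, add_comm]
  have h : (ξ.2 (𝔸.bracket σ τ ξ.1) : ℝ) = - (ξ.2 (𝔸.bracket τ σ ξ.1) : ℝ) := by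
    rw [hskew]; exact map_neg ξ.2 _
  unfold affineBracket
  rw [h]; ring

theorem affineBracket_sub (𝔸 : LieAlgebroid m F A) (ξ : DualSpace F A) (σ σ' τ : Sec m F A)
    (f f' g : Fn m M) : affineBracket 𝔸 ξ (σ - σ') (f - f') τ g =
      affineBracket 𝔸 ξ σ f τ g - affineBracket 𝔸 ξ σ' f' τ g := by
  have h1 : (ξ.2 (𝔸.bracket (σ - σ') τ ξ.1) : ℝ) =
      (ξ.2 (𝔸.bracket σ τ ξ.1) : ℝ) - (ξ.2 (𝔸.bracket σ' τ ξ.1) : ℝ) := by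
    rw [map_sub]; exact map_sub ξ.2 _ _
  have h2 : lieDeriv g ξ.1 (𝔸.anchor ξ.1 ((σ - σ') ξ.1)) =
      lieDeriv g ξ.1 (𝔸.anchor ξ.1 (σ ξ.1)) - lieDeriv g ξ.1 (𝔸.anchor ξ.1 (σ' ξ.1)) := by
    have e : 𝔸.anchor ξ.1 ((σ - σ') ξ.1) = 𝔸.anchor ξ.1 (σ ξ.1) - 𝔸.anchor ξ.1 (σ' ξ.1) :=
      map_sub (𝔸.anchor ξ.1) _ _
    rw [e]
    exact map_sub (mfderiv (𝓡 m) 𝓘(ℝ, ℝ) g ξ.1) _ _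
  have h3 : lieDeriv (f - f') ξ.1 (𝔸.anchor ξ.1 (τ ξ.1)) =
      lieDeriv f ξ.1 (𝔸.anchor ξ.1 (τ ξ.1)) - lieDeriv f' ξ.1 (𝔸.anchor ξ.1 (τ ξ.1)) :=
    congrArg (fun L : TangentSpace (𝓡 m) ξ.1 →L[ℝ] ℝ => L (𝔸.anchor ξ.1 (τ ξ.1)))
      (mfderiv_sub (fn_mdiff f ξ.1) (fn_mdiff f' ξ.1))
  unfold affineBracket
  rw [h1, h2]
  erw [h3]
  ring

theorem poisson_apply (𝔸 : LieAlgebroid m F A) (ξ : DualSpace F A) (σ τ : Sec m F A)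
    (f g : Fn m M) :
    poisson 𝔸 ξ (dDual m (affineFn σ f) ξ) (dDual m (affineFn τ g) ξ) =
      affineBracket 𝔸 ξ σ f τ g := by
  have hex : ∃ r : (Sec m F A × Fn m M) × (Sec m F A × Fn m M),
      dDual m (affineFn σ f) ξ = dDual m (affineFn r.1.1 r.1.2) ξ ∧
      dDual m (affineFn τ g) ξ = dDual m (affineFn r.2.1 r.2.2) ξ := ⟨((σ, f), (τ, g)), rfl, rfl⟩
  unfold poisson
  rw [dif_pos hex]
  obtain ⟨h1, h2⟩ := hex.choose_spec
  set r := hex.choose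
  have k1 := affineBracket_eq_zero 𝔸 ξ (σ - r.1.1) r.2.1 (f - r.1.2) r.2.2 (dDual_sub _ _ _ _ ξ h1)
  have k2 := affineBracket_eq_zero 𝔸 ξ (τ - r.2.1) σ (g - r.2.2) f (dDual_sub _ _ _ _ ξ h2)
  rw [affineBracket_sub] at k1 k2
  have s1 := affineBracket_skew 𝔸 ξ τ σ g f
  have s2 := affineBracket_skew 𝔸 ξ r.2.1 σ r.2.2 f
  linarith

end PoissonWellDefined

end WLA

end

/-! Both (b) and (c) are compared with (a): `poisson` and `dA` are determined by anchor and bracket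
through derivation rules, so (a) follows by evaluating them on generators and implies (b) and (c) by
propagating degrees from generators.

For (c), every term of the formula for `dA` has the right degree once anchor and bracket do.
Conversely, d_A f (σ) = a(σ)f recovers the anchor, and for a 1-form η the identity η([σ,τ]) =
a(σ)η(τ) − a(τ)η(σ) − (d_A η)(σ,τ) shows that [σ,τ] pairs with 1-forms as a section of degree i + j
must. These pairings detect the filtration (`mem_fil_of_forms`): the cut-off coframe dual to an
adapted frame has degrees −vₐ and reads off the coefficients.

For (b), the brackets of the generators f_σ and p^*g are f_{[σ,τ]}, p^*(a(σ)g) and 0. To get (a),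
the degree of a section or function is recovered from its polynomial function; scaling the fibres
isolates the homogeneous component (`mem_homPoly_of_mem_polyFn`). To get (b), the Leibniz rule is
applied in both slots, polynomial functions being generated near each fibre by the f_σ and p^*h
(`locPoly_induction`, `pb_mem_bracketPoly`). Since `poisson` is defined pointwise by choosing
representatives f_σ + p^*f of the covectors, its bilinearity is used only on differentials of such
functions; those of polynomial functions are of this kind (`isAffineAt_of_mem_locPoly`).

Anchor and bracket act on global sections, while frames and monomials are local; bump functions
mediate. -/

noncomputable section

namespace WLA

variable {m : ℕ} {M : Type*} [TopologicalSpace M] [ChartedSpace (EuclideanSpace ℝ (Fin m)) M]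
  [IsManifold (𝓡 m) ∞ M] [T2Space M]
  {F : Type*} [NormedAddCommGroup F] [NormedSpace ℝ F] [FiniteDimensional ℝ F]
  {A : M → Type*} [TopologicalSpace (TotalSpace F A)] [∀ x, AddCommGroup (A x)]
  [∀ x, Module ℝ (A x)] [∀ x, TopologicalSpace (A x)] [FiberBundle F A] [VectorBundle ℝ F A]
  [ContMDiffVectorBundle ∞ F A (𝓡 m)]

/-! ### Extension of germs -/

theorem exists_bump (U : Opens M) {p : M} (hp : p ∈ U) :
    ∃ ψ : Fn m M, tsupport ψ ⊆ U ∧ ∀ᶠ x in 𝓝 p, ψ x = 1 := by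
  obtain ⟨ψ, -, hψ⟩ := (SmoothBumpFunction.nhds_basis_tsupport (I := 𝓡 m) p).mem_iff.1
    (U.isOpen.mem_nhds hp)
  exact ⟨⟨ψ, ψ.contMDiff⟩, hψ, ψ.eventuallyEq_one⟩

/-- A germ form of the gluing axiom: the local representative may change from point to point and
live on an open set unrelated to U. -/
theorem Weighting.fil_of_eventuallyEq (W : Weighting m M) {i : ℤ} {U : Opens M} {f : M → ℝ}
    (h : ∀ p ∈ U, ∃ (V : Opens M) (g : M → ℝ), p ∈ V ∧ g ∈ W.Fil i V ∧ ∀ᶠ x in 𝓝 p, f x = g x) :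
    f ∈ W.Fil i U := by
  refine W.glue fun p hp => ?_
  obtain ⟨V, g, hpV, hg, he⟩ := h p hp
  obtain ⟨N, hN, hNo, hpN⟩ := eventually_nhds_iff.1 he
  refine ⟨U ⊓ V ⊓ ⟨N, hNo⟩, ⟨⟨hp, hpV⟩, hpN⟩, fun x hx => hx.1.1, ?_⟩
  refine W.congr' (W.restrict hg fun x hx => hx.1.2) fun x hx => ?_
  exact (hN x hx.2).symm

theorem LinearWeighting.fil_of_eventuallyEq {W : Weighting m M} (L : LinearWeighting F A W)
    {i : ℤ} {U : Opens M} {σ : ∀ x, A x}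
    (h : ∀ p ∈ U, ∃ (V : Opens M) (τ : ∀ x, A x), p ∈ V ∧ τ ∈ L.Fil i V ∧
      ∀ᶠ x in 𝓝 p, σ x = τ x) :
    σ ∈ L.Fil i U := by
  refine L.glue fun p hp => ?_
  obtain ⟨V, g, hpV, hg, he⟩ := h p hp
  obtain ⟨N, hN, hNo, hpN⟩ := eventually_nhds_iff.1 he
  refine ⟨U ⊓ V ⊓ ⟨N, hNo⟩, ⟨⟨hp, hpV⟩, hpN⟩, fun x hx => hx.1.1, ?_⟩
  refine L.congr' (L.restrict hg fun x hx => hx.1.2) fun x hx => ?_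
  exact (hN x hx.2).symm

theorem eventually_eq_zero_of_notMem_tsupport {ψ : M → ℝ} {p : M} (hp : p ∉ tsupport ψ) :
    ∀ᶠ x in 𝓝 p, ψ x = 0 := by
  filter_upwards [(isClosed_tsupport ψ).isOpen_compl.mem_nhds hp] with x hx
  exact image_eq_zero_of_notMem_tsupport hx

/-- Near the support of ψ this is a product with a function of degree 0; elsewhere it vanishes
locally. -/
theorem Weighting.cutoff (W : Weighting m M) {i : ℤ} {U : Opens M} {f : M → ℝ}
    (hf : f ∈ W.Fil i U) (ψ : Fn m M) (hψ : tsupport ψ ⊆ U) :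
    (fun x => ψ x * f x) ∈ W.Fil i ⊤ := by
  refine W.fil_of_eventuallyEq fun p _ => ?_
  by_cases hp : p ∈ tsupport ψ
  · refine ⟨U, _, hψ hp, ?_, Filter.Eventually.of_forall fun x => rfl⟩
    have := W.mul (W.nonpos (U := U) (le_refl (0 : ℤ)) ψ.contMDiff.contMDiffOn) hf
    rwa [zero_add] at this
  · refine ⟨⊤, 0, trivial, zero_mem _, ?_⟩
    filter_upwards [eventually_eq_zero_of_notMem_tsupport hp] with x hx
    simp [hx]

theorem LinearWeighting.cutoff {W : Weighting m M} (L : LinearWeighting F A W) {i : ℤ}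
    {U : Opens M} {σ : ∀ x, A x} (hσ : σ ∈ L.Fil i U) (ψ : Fn m M) (hψ : tsupport ψ ⊆ U) :
    (fun x => ψ x • σ x) ∈ L.Fil i ⊤ := by
  refine L.fil_of_eventuallyEq fun p _ => ?_
  by_cases hp : p ∈ tsupport ψ
  · exact ⟨U, _, hψ hp, L.smul ψ.contMDiff.contMDiffOn hσ, Filter.Eventually.of_forall fun x => rfl⟩
  · refine ⟨⊤, 0, trivial, zero_mem _, ?_⟩
    filter_upwards [eventually_eq_zero_of_notMem_tsupport hp] with x hx
    simp [hx]

/-- A global function of filtration degree `i`, as a smooth function. -/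
def Weighting.toFn (W : Weighting m M) {i : ℤ} {f : M → ℝ} (hf : f ∈ W.Fil i ⊤) : Fn m M :=
  ⟨f, contMDiffOn_univ.1 (W.smooth hf)⟩

/-- A global section of filtration degree `i`, as a smooth section. -/
def LinearWeighting.toSec {W : Weighting m M} (L : LinearWeighting F A W) {i : ℤ}
    {σ : ∀ x, A x} (hσ : σ ∈ L.Fil i ⊤) : Sec m F A :=
  ⟨σ, contMDiffOn_univ.1 (L.smooth hσ)⟩

theorem Weighting.exists_extension (W : Weighting m M) {i : ℤ} {U : Opens M} {f : M → ℝ}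
    (hf : f ∈ W.Fil i U) {p : M} (hp : p ∈ U) :
    ∃ g : Fn m M, ⇑g ∈ W.Fil i ⊤ ∧ ∀ᶠ x in 𝓝 p, f x = g x := by
  obtain ⟨ψ, hψ, h1⟩ := exists_bump (m := m) U hp
  refine ⟨W.toFn (W.cutoff hf ψ hψ), W.cutoff hf ψ hψ, ?_⟩
  filter_upwards [h1] with x hx
  change f x = ψ x * f x
  rw [hx, one_mul]

theorem LinearWeighting.exists_extension {W : Weighting m M} (L : LinearWeighting F A W) {i : ℤ}
    {U : Opens M} {σ : ∀ x, A x} (hσ : σ ∈ L.Fil i U) {p : M} (hp : p ∈ U) :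
    ∃ τ : Sec m F A, ⇑τ ∈ L.Fil i ⊤ ∧ ∀ᶠ x in 𝓝 p, σ x = τ x := by
  obtain ⟨ψ, hψ, h1⟩ := exists_bump (m := m) U hp
  refine ⟨L.toSec (L.cutoff hσ ψ hψ), L.cutoff hσ ψ hψ, ?_⟩
  filter_upwards [h1] with x hx
  change σ x = ψ x • σ x
  rw [hx, one_smul]

/-- The filtration of sections is compatible with that of functions. -/
theorem LinearWeighting.fil_smul {W : Weighting m M} (L : LinearWeighting F A W) {i j : ℤ}
    {U : Opens M} {f : M → ℝ} {σ : ∀ x, A x} (hf : f ∈ W.Fil i U) (hσ : σ ∈ L.Fil j U) :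
    (fun x => f x • σ x) ∈ L.Fil (i + j) U := by
  refine L.fil_of_eventuallyEq fun p hp => ?_
  obtain ⟨V, hpV, s, v, -, hV⟩ := L.exists_frame p
  -- The frame describes the filtration over V only, and V need not be comparable with U, so both
  -- factors are first replaced by global ones with the same germ at p.
  obtain ⟨f', hf', hff'⟩ := W.exists_extension hf hp
  obtain ⟨σ', hσ', hσσ'⟩ := L.exists_extension hσ hp
  obtain ⟨c, hc, hcσ⟩ := (hV j σ').1 (L.restrict hσ' le_top)
  refine ⟨V, fun x => f' x • σ' x, hpV, (hV _ _).2 ⟨fun a => f' * c a, fun a => ?_, ?_⟩, ?_⟩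
  · have := W.mul (W.restrict hf' (le_top (a := V))) (hc a)
    rwa [← add_sub_assoc] at this
  · intro x hx
    rw [hcσ x hx, Finset.smul_sum]
    exact Finset.sum_congr rfl fun a _ => smul_smul _ _ _
  · filter_upwards [hff', hσσ'] with x h1 h2
    rw [h1, h2]

/-! ### Coefficients with respect to a local frame -/

/-- In a trivialization the frame becomes an invertible linear map Φ(x) : ℝᵏ → F depending smoothly
on x, and the coefficients of τ are Φ(x)⁻¹ applied to τ. Inversion is smooth at every invertible
map. -/
theorem contMDiffOn_coeff {U : Opens M} {s : Fin (Module.finrank ℝ F) → ∀ x, A x}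
    (hs : IsLocalFrameOn (𝓡 m) F ∞ s U) (τ : Sec m F A) (a : Fin (Module.finrank ℝ F)) :
    ContMDiffOn (𝓡 m) 𝓘(ℝ, ℝ) ∞ (fun x => hs.coeff a x (τ x)) U := by
  intro p hp
  refine ContMDiffAt.contMDiffWithinAt ?_
  let t := trivializationAt F A p
  have hpt : p ∈ t.baseSet := FiberBundle.mem_baseSet_trivializationAt F A p
  have hsm : ∀ b, ContMDiffAt (𝓡 m) 𝓘(ℝ, F) ∞ (fun x => (t ⟨x, s b x⟩).2) p := fun b =>
    (contMDiffAt_section p).1 (hs.contMDiffAt U.isOpen hp b)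
  have hτm : ContMDiffAt (𝓡 m) 𝓘(ℝ, F) ∞ (fun x => (t ⟨x, τ x⟩).2) p :=
    (contMDiffAt_section p).1 (τ.contMDiff p)
  let Φ : M → (Fin (Module.finrank ℝ F) → ℝ) →L[ℝ] F := fun x =>
    ∑ b, ContinuousLinearMap.smulRightL ℝ (Fin (Module.finrank ℝ F) → ℝ) F (ContinuousLinearMap.proj b)
      (t ⟨x, s b x⟩).2
  have hΦ : ContMDiffAt (𝓡 m) 𝓘(ℝ, (Fin (Module.finrank ℝ F) → ℝ) →L[ℝ] F) ∞ Φ p := by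
    refine contMDiffAt_finsetSum fun b _ => ?_
    exact (ContinuousLinearMap.contMDiff _).contMDiffAt.comp p (hsm b)
  have key : ∀ x ∈ (U : Set M) ∩ t.baseSet, ∃ E : (Fin (Module.finrank ℝ F) → ℝ) ≃L[ℝ] F, (E : _ →L[ℝ] F) = Φ x ∧
      ∀ v : A x, E.symm (t ⟨x, v⟩).2 = fun b => hs.coeff b x v := by
    rintro x ⟨hxU, hxt⟩
    let E : (Fin (Module.finrank ℝ F) → ℝ) ≃L[ℝ] F :=
      ((hs.toBasisAt hxU).equivFun.symm.trans (t.linearEquivAt ℝ x hxt)).toContinuousLinearEquiv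
    have hE : ∀ c, E c = (t ⟨x, ∑ b, c b • s b x⟩).2 := by
      intro c
      change (t ⟨x, (hs.toBasisAt hxU).equivFun.symm c⟩).2 = _
      simp [Module.Basis.equivFun_symm_apply]
    refine ⟨E, ?_, ?_⟩
    · ext c
      have h1 : ∀ v, (t ⟨x, v⟩).2 = t.linearEquivAt ℝ x hxt v := fun _ => rfl
      change E _ = _
      rw [hE, h1, map_sum]
      simp only [map_smul, Φ, h1]
      simp
    · intro v
      have hv : ∑ b, hs.coeff b x v • s b x = v := by
        simpa [IsLocalFrameOn.coeff, hxU] using (hs.toBasisAt hxU).sum_repr v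
      rw [ContinuousLinearEquiv.symm_apply_eq, hE, hv]
  have hmem : (U : Set M) ∩ t.baseSet ∈ 𝓝 p :=
    Filter.inter_mem (U.isOpen.mem_nhds hp) (t.open_baseSet.mem_nhds hpt)
  obtain ⟨E, hE, -⟩ := key p ⟨hp, hpt⟩
  have hinv : ContMDiffAt (𝓡 m) 𝓘(ℝ, F →L[ℝ] (Fin (Module.finrank ℝ F) → ℝ)) ∞
      (fun x => ContinuousLinearMap.inverse (Φ x)) p := by
    refine ContDiffAt.comp_contMDiffAt (g := ContinuousLinearMap.inverse) ?_ hΦ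
    rw [← hE]
    exact contDiffAt_map_inverse E
  have happ := (contMDiffAt_pi_space.1 (hinv.clm_apply hτm)) a
  refine happ.congr_of_eventuallyEq ?_
  filter_upwards [hmem] with x hx
  obtain ⟨E', hE', hc⟩ := key x hx
  rw [← hE', ContinuousLinearMap.inverse_equiv]
  exact (congrFun (hc (τ x)) a).symm

theorem coeff_eq_of_eq_sum {U : Opens M} {s : Fin (Module.finrank ℝ F) → ∀ x, A x}
    (hs : IsLocalFrameOn (𝓡 m) F ∞ s U) {x : M} (hx : x ∈ U) {v : A x}
    {c : Fin (Module.finrank ℝ F) → ℝ} (h : v = ∑ b, c b • s b x)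
    (a : Fin (Module.finrank ℝ F)) : hs.coeff a x v = c a := by
  have hx' : x ∈ (U : Set M) := hx
  subst h
  have : ∑ b, c b • s b x = (hs.toBasisAt hx').equivFun.symm c := by
    simp [Module.Basis.equivFun_symm_apply]
  have hcoord : ∀ w, hs.coeff a x w = (hs.toBasisAt hx').equivFun w a := fun w => by
    simp [IsLocalFrameOn.coeff, hx']
  rw [hcoord, this, LinearEquiv.apply_symm_apply]

/-! ### Detecting the filtration of sections by 1-forms -/

/-- The form `ψ σₐ*`, where `σₐ*` is an element of the coframe dual to a local frame. -/
def coframe {U : Opens M} {s : Fin (Module.finrank ℝ F) → ∀ x, A x}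
    (hs : IsLocalFrameOn (𝓡 m) F ∞ s U) (ψ : Fn m M) (hψ : tsupport ψ ⊆ U)
    (a : Fin (Module.finrank ℝ F)) : Form m F A 1 where
  toFun x := AlternatingMap.ofSubsingleton ℝ (A x) ℝ (0 : Fin 1) (ψ x • hs.coeff a x)
  smooth σ := by
    change ContMDiff (𝓡 m) 𝓘(ℝ, ℝ) ∞ (fun x => ψ x * hs.coeff a x (σ 0 x))
    refine contMDiff_of_tsupport fun x hx => ?_
    have hxU : x ∈ U := hψ (tsupport_mul_subset_left hx)
    exact (ψ.contMDiff x).mul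
      ((contMDiffOn_coeff hs (σ 0) a).contMDiffAt (U.isOpen.mem_nhds hxU))

theorem coframe_eval {U : Opens M} {s : Fin (Module.finrank ℝ F) → ∀ x, A x}
    (hs : IsLocalFrameOn (𝓡 m) F ∞ s U) (ψ : Fn m M) (hψ : tsupport ψ ⊆ U)
    (a : Fin (Module.finrank ℝ F)) (σ : Fin 1 → Sec m F A) :
    (coframe hs ψ hψ a).eval σ = fun x => ψ x * hs.coeff a x (σ 0 x) := rfl

/-- The filtration of sections of `A` is determined by the pairing with `1`-forms. -/
theorem mem_fil_of_forms {W : Weighting m M} (L : LinearWeighting F A W) (l : ℤ) (ρ : Sec m F A)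
    (h : ∀ (i : ℤ) (η : Form m F A 1), η.eval ∈ FormFil L 1 i →
      η.eval (fun _ => ρ) ∈ W.Fil (i + l) ⊤) : ⇑ρ ∈ L.Fil l ⊤ := by
  refine L.fil_of_eventuallyEq fun p _ => ?_
  obtain ⟨U, hpU, s, v, hs, hU⟩ := L.exists_frame p
  obtain ⟨ψ, hψ, h1⟩ := exists_bump (m := m) U hpU
  -- The local model for ρ is its frame expansion with cut-off coefficients: each one is the value
  -- on ρ of a global form, to which the hypothesis applies.
  refine ⟨U, fun x => ∑ a, (ψ x * hs.coeff a x (ρ x)) • s a x, hpU,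
    (hU _ _).2 ⟨_, fun a => ?_, fun x _ => rfl⟩, ?_⟩
  -- The a-th coefficient of a section of degree j has degree j − vₐ, so the a-th coframe element
  -- has degree −vₐ.
  · have hc : (coframe hs ψ hψ a).eval ∈ FormFil L 1 (-v a) := by
      intro j σ hσ
      rw [coframe_eval]
      obtain ⟨c, hc, hcσ⟩ := (hU _ _).1 (L.restrict (hσ 0) (le_top (a := U)))
      have : (fun x => hs.coeff a x (σ 0 x)) ∈ W.Fil (-v a + ∑ l, j l) U := by
        have e : -v a + ∑ l, j l = j 0 - v a := by simp; ring
        rw [e]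
        exact W.congr' (hc a) fun x hx => (coeff_eq_of_eq_sum hs hx (hcσ x hx) a).symm
      exact W.cutoff this ψ hψ
    have := h _ _ hc
    rw [coframe_eval, neg_add_eq_sub] at this
    exact W.restrict this le_top
  · filter_upwards [h1, U.isOpen.mem_nhds hpU] with x hx hxU
    simp only [hx, one_mul]
    exact hs.coeff_sum_eq (⇑ρ) hxU

/-! ### The differential: equivalence of (a) and (c) -/

theorem anchor_section_smooth (𝔸 : LieAlgebroid m F A) (σ : Sec m F A) :
    ContMDiff (𝓡 m) (𝓡 m).tangent ∞
      (fun x => (⟨x, 𝔸.anchor x (σ x)⟩ : TangentBundle (𝓡 m) M)) :=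
  𝔸.anchor_smooth.comp σ.contMDiff

/-- Each term has degree i + ∑ j: a bracket merges two arguments into one whose degree is the sum of
theirs, and the anchor of an argument raises the degree by that of the argument. -/
theorem IsInfMultiplicative.differentialPreservesFiltration {𝔸 : LieAlgebroid m F A}
    {W : Weighting m M} {L : LinearWeighting F A W} (h : IsInfMultiplicative 𝔸 L) :
    DifferentialPreservesFiltration 𝔸 L := by
  intro k i η hη j s hs
  refine Submodule.add_mem (W.Fil _ ⊤) (x := bracketTerms 𝔸 η s) ?_ ?_
  · cases k with
    | zero => exact zero_mem _
    | succ n =>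
      have e : bracketTerms 𝔸 η s = ∑ b : Fin (n + 2), ∑ a : Fin (n + 1),
          if a.castSucc < b then (-1 : ℝ) ^ ((a : ℕ) + (b : ℕ)) •
            η.eval (Fin.cons (𝔸.bracket (s a.castSucc) (s b))
              (fun l : Fin n => s (b.succAbove (a.succAbove l)))) else 0 := by
        funext x
        simp only [bracketTerms, Finset.sum_apply]
        refine Finset.sum_congr rfl fun b _ => Finset.sum_congr rfl fun a _ => ?_
        split_ifs <;> rfl
      rw [e]
      refine Submodule.sum_mem _ fun b _ => Submodule.sum_mem _ fun a _ => ?_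
      split_ifs with hab
      · refine Submodule.smul_mem _ _ ?_
        have := hη (Fin.cons (j a.castSucc + j b) fun l => j (b.succAbove (a.succAbove l)))
          (Fin.cons (𝔸.bracket (s a.castSucc) (s b))
              (fun l : Fin n => s (b.succAbove (a.succAbove l)))) (by
            intro l
            refine Fin.cases ?_ (fun l => ?_) l
            · exact h.2 _ _ _ _ (hs _) (hs _)
            · exact hs _)
        convert this using 3
        -- Splitting off b and then a from the total degree; since a lies below b, removing b does
        -- not shift the index a.
        rw [Fin.sum_univ_succAbove j b, Fin.sum_cons,
          Fin.sum_univ_succAbove (fun l => j (b.succAbove l)) a,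
          Fin.succAbove_of_castSucc_lt b a hab]
        ring
      · exact zero_mem _
  · have e : (fun x => ∑ a : Fin (k + 1), (-1 : ℝ) ^ (a : ℕ) *
        lieDeriv (η.eval (fun l => s (a.succAbove l))) x (𝔸.anchor x (s a x))) =
        ∑ a : Fin (k + 1), (-1 : ℝ) ^ (a : ℕ) • fun x =>
          lieDeriv (η.eval (fun l => s (a.succAbove l))) x (𝔸.anchor x (s a x)) := by
      funext x
      simp [Finset.sum_apply]
    rw [e]
    refine Submodule.sum_mem _ fun a _ => Submodule.smul_mem _ _ ?_
    have h1 := hη (fun l => j (a.succAbove l)) (fun l => s (a.succAbove l)) fun l => hs _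
    have h2 := (h.1 _ _ (hs a)).2 _ _ h1
    convert h2 using 2
    rw [Fin.sum_univ_succAbove j a]
    ring

/-- A smooth function as a form of degree zero. -/
def Form.ofFn (f : Fn m M) : Form m F A 0 where
  toFun x := AlternatingMap.constOfIsEmpty ℝ (A x) (Fin 0) (f x)
  smooth _ := f.contMDiff

theorem dA_one (𝔸 : LieAlgebroid m F A) (η : Form m F A 1) (σ τ : Sec m F A) (x : M) :
    dA 𝔸 η ![σ, τ] x = - η.eval (fun _ => 𝔸.bracket σ τ) x +
      (lieDeriv (η.eval fun _ => τ) x (𝔸.anchor x (σ x)) -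
        lieDeriv (η.eval fun _ => σ) x (𝔸.anchor x (τ x))) := by
  let s : Fin 2 → Sec m F A := ![σ, τ]
  have f1 : (fun l : Fin 1 => s ((0 : Fin 2).succAbove l)) = fun _ => τ := by
    funext l; fin_cases l; rfl
  have f2 : (fun l : Fin 1 => s ((1 : Fin 2).succAbove l)) = fun _ => σ := by
    funext l; fin_cases l; rfl
  have f3 : (Fin.cons (𝔸.bracket σ τ)
      (fun l : Fin 0 => s ((1 : Fin 2).succAbove ((0 : Fin 1).succAbove l))) :
      Fin 1 → Sec m F A) = fun _ => 𝔸.bracket σ τ := by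
    funext l; fin_cases l; rfl
  change (∑ b : Fin 2, ∑ a : Fin 1, if a.castSucc < b then
      (-1 : ℝ) ^ ((a : ℕ) + (b : ℕ)) * η.eval (Fin.cons (𝔸.bracket (s a.castSucc) (s b))
        (fun l : Fin 0 => s (b.succAbove (a.succAbove l)))) x else 0) +
    ∑ a : Fin 2, (-1 : ℝ) ^ (a : ℕ) *
      lieDeriv (η.eval (fun l : Fin 1 => s (a.succAbove l))) x (𝔸.anchor x (s a x)) = _
  rw [Fin.sum_univ_two, Fin.sum_univ_two, Fin.sum_univ_one, Fin.sum_univ_one, f1, f2]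
  have g0 : s 0 = σ := rfl
  have g1 : s 1 = τ := rfl
  simp only [Fin.castSucc_zero, g0, g1, f3]
  simp
  ring

/-- Only forms of degree 0 and 1 are needed: the former give the anchor, and then the formula for
`dA` on the latter can be solved for η([σ,τ]). -/
theorem DifferentialPreservesFiltration.isInfMultiplicative {𝔸 : LieAlgebroid m F A}
    {W : Weighting m M} {L : LinearWeighting F A W}
    (h : DifferentialPreservesFiltration 𝔸 L) : IsInfMultiplicative 𝔸 L := by
  have hanchor : ∀ (i : ℤ) (σ : Sec m F A), ⇑σ ∈ L.Fil i ⊤ →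
      (fun x => 𝔸.anchor x (σ x)) ∈ W.vectorFields i := by
    refine fun i σ hσ => ⟨anchor_section_smooth 𝔸 σ, fun j f hf => ?_⟩
    have h0 := h 0 j (Form.ofFn (F := F) (A := A) (W.toFn hf)) (by
      intro l s _
      have : j + ∑ a, l a = j := by simp
      rw [this]
      exact hf) (fun _ => i) (fun _ => σ) fun _ => hσ
    have e : dA 𝔸 (Form.ofFn (F := F) (A := A) (W.toFn hf)) (fun _ => σ) =
        fun x => lieDeriv f x (𝔸.anchor x (σ x)) := by
      funext x
      simp only [dA, bracketTerms]
      simp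
      rfl
    rw [e] at h0
    simpa [add_comm] using h0
  refine ⟨hanchor, fun i j σ τ hσ hτ => ?_⟩
  refine mem_fil_of_forms L _ _ fun d η hη => ?_
  have h1 := h 1 d η hη ![i, j] ![σ, τ] (by
    intro l
    fin_cases l
    · exact hσ
    · exact hτ)
  have hσ1 := (hanchor _ _ hσ).2 _ _ (hη (fun _ => j) (fun _ => τ) fun _ => hτ)
  have hτ1 := (hanchor _ _ hτ).2 _ _ (hη (fun _ => i) (fun _ => σ) fun _ => hσ)
  change dA 𝔸 η ![σ, τ] ∈ W.Fil (d + ∑ l : Fin 2, ![i, j] l) ⊤ at h1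
  simp only [Fin.sum_univ_two, Matrix.cons_val_zero, Matrix.cons_val_one] at h1
  simp only [Finset.univ_unique, Finset.sum_singleton] at hσ1 hτ1
  have e1 : i + (d + j) = d + (i + j) := by ring
  have e2 : j + (d + i) = d + (i + j) := by ring
  rw [e1] at hσ1
  rw [e2] at hτ1
  have h2 := Submodule.sub_mem _ (Submodule.sub_mem _ hσ1 hτ1) h1
  refine W.congr' h2 fun x _ => ?_
  simp only [Pi.sub_apply, dA_one]
  ring

section Germs

/-! ### Germs of polynomial functions on `A*` -/

variable (F A) in
/-- The pullback to `A*` of a function on `M`. -/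
def pullback (h : M → ℝ) : DualSpace F A → ℝ := fun ξ => h ξ.1

/-- The fibrewise linear function on `A*` defined by a section of `A`. -/
def fibreLinear (σ : ∀ x, A x) : DualSpace F A → ℝ := fun ξ => ξ.2 (σ ξ.1)

variable (F A) in
/-- The neighbourhoods of the fibre of `A*` over `p` that are preimages of subsets of `M`. -/
def nearFibre (p : M) : Filter (DualSpace F A) := Filter.comap (fun ξ => ξ.1) (𝓝 p)

theorem eventually_nearFibre {p : M} {P : DualSpace F A → Prop} :
    (∀ᶠ ξ in nearFibre F A p, P ξ) ↔
      ∃ U : Opens M, p ∈ U ∧ ∀ ξ : DualSpace F A, ξ.1 ∈ U → P ξ := by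
  rw [nearFibre, Filter.eventually_comap, eventually_nhds_iff]
  constructor
  · rintro ⟨t, ht, ho, hp⟩
    exact ⟨⟨t, ho⟩, hp, fun ξ hξ => ht _ hξ _ rfl⟩
  · rintro ⟨U, hp, hU⟩
    refine ⟨U, fun x hx ξ hξ => hU ξ ?_, U.isOpen, hp⟩
    rw [hξ]; exact hx

theorem eventually_nearFibre_of_base {p : M} {P : M → Prop} (h : ∀ᶠ x in 𝓝 p, P x) :
    ∀ᶠ ξ in nearFibre F A p, P ξ.1 :=
  Filter.tendsto_comap.eventually h

/-- Preimages of open subsets of M are open in A*. This lets functions that agree near a fibre be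
differentiated there. -/
theorem eventually_eventually_nearFibre {p : M} {P : DualSpace F A → Prop}
    (h : ∀ᶠ ξ in nearFibre F A p, P ξ) : ∀ᶠ ξ in nearFibre F A p, ∀ᶠ ζ in 𝓝 ξ, P ζ := by
  obtain ⟨U, hp, hU⟩ := eventually_nearFibre.1 h
  refine eventually_nearFibre.2 ⟨U, hp, fun ξ hξ => ?_⟩
  have hc : Continuous (fun ζ : DualSpace F A => ζ.1) :=
    FiberBundle.continuous_proj (F →L[ℝ] ℝ) (fun x => A x →L[ℝ] Bundle.Trivial M ℝ x)
  filter_upwards [(U.isOpen.preimage hc).mem_nhds hξ] with ζ hζ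
  exact hU ζ hζ

theorem eventually_nearFibre_apply {p : M} {P : DualSpace F A → Prop}
    (h : ∀ᶠ ξ in nearFibre F A p, P ξ) {ξ : DualSpace F A} (hξ : ξ.1 = p) : P ξ := by
  obtain ⟨U, hp, hU⟩ := eventually_nearFibre.1 h
  exact hU ξ (hξ ▸ hp)

variable {W : Weighting m M} (L : LinearWeighting F A W)

theorem monomials_restrict {n : ℕ} {i : ℤ} {U V : Opens M} (h : V ≤ U) :
    monomials L n i U ⊆ monomials L n i V := by
  rintro _ ⟨f, σ, a, b, hf, hσ, hab, rfl⟩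
  exact ⟨f, σ, a, b, W.restrict hf h, fun l => L.restrict (hσ l) h, hab, rfl⟩

/-- The functions on `A*` that agree near the fibre over `p` with a homogeneous polynomial function
of degree `n` and filtration degree `i`. -/
def locPoly (n : ℕ) (i : ℤ) (p : M) : Submodule ℝ (DualSpace F A → ℝ) where
  carrier := {G | ∃ U : Opens M, p ∈ U ∧
    ∃ P ∈ Submodule.span ℝ (monomials L n i U), ∀ ξ : DualSpace F A, ξ.1 ∈ U → G ξ = P ξ}
  zero_mem' := ⟨⊤, trivial, 0, zero_mem _, fun _ _ => rfl⟩
  add_mem' := by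
    rintro G H ⟨U, hpU, P, hP, hG⟩ ⟨V, hpV, Q, hQ, hH⟩
    refine ⟨U ⊓ V, ⟨hpU, hpV⟩, P + Q, add_mem
      (Submodule.span_mono (monomials_restrict L inf_le_left) hP)
      (Submodule.span_mono (monomials_restrict L inf_le_right) hQ), fun ξ hξ => ?_⟩
    simp [hG ξ hξ.1, hH ξ hξ.2]
  smul_mem' := by
    rintro c G ⟨U, hpU, P, hP, hG⟩
    exact ⟨U, hpU, c • P, Submodule.smul_mem _ _ hP, fun ξ hξ => by simp [hG ξ hξ]⟩

theorem mem_homPoly_iff {n : ℕ} {i : ℤ} {G : DualSpace F A → ℝ} :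
    G ∈ homPoly L n i ↔ ∀ p, G ∈ locPoly L n i p := Iff.rfl

variable {L}

theorem locPoly_congr {n : ℕ} {i : ℤ} {p : M} {G H : DualSpace F A → ℝ}
    (hG : G ∈ locPoly L n i p) (h : ∀ᶠ ξ in nearFibre F A p, H ξ = G ξ) :
    H ∈ locPoly L n i p := by
  obtain ⟨U, hpU, P, hP, hG⟩ := hG
  obtain ⟨V, hpV, hV⟩ := eventually_nearFibre.1 h
  exact ⟨U ⊓ V, ⟨hpU, hpV⟩, P, Submodule.span_mono (monomials_restrict L inf_le_left) hP,
    fun ξ hξ => (hV ξ hξ.2).trans (hG ξ hξ.1)⟩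

theorem monomials_mul {n n' : ℕ} {i i' : ℤ} {U : Opens M} {P Q : DualSpace F A → ℝ}
    (hP : P ∈ monomials L n i U) (hQ : Q ∈ monomials L n' i' U) :
    P * Q ∈ monomials L (n + n') (i + i') U := by
  obtain ⟨h, σ, a, b, hh, hσ, hab, rfl⟩ := hP
  obtain ⟨h', σ', a', b', hh', hσ', hab', rfl⟩ := hQ
  refine ⟨h * h', Fin.append σ σ', a + a', Fin.append b b', W.mul hh hh', fun l => ?_, ?_, ?_⟩
  · refine Fin.addCases (fun l => ?_) (fun l => ?_) l
    · simpa using hσ l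
    · simpa using hσ' l
  · simp only [Fin.sum_univ_add, Fin.append_left, Fin.append_right]
    linarith
  · funext ξ
    simp only [Pi.mul_apply, Fin.prod_univ_add, Fin.append_left, Fin.append_right]
    ring

theorem locPoly_mul {n n' : ℕ} {i i' : ℤ} {p : M} {G H : DualSpace F A → ℝ}
    (hG : G ∈ locPoly L n i p) (hH : H ∈ locPoly L n' i' p) :
    G * H ∈ locPoly L (n + n') (i + i') p := by
  obtain ⟨U, hpU, P, hP, hG⟩ := hG
  obtain ⟨V, hpV, Q, hQ, hH⟩ := hH
  replace hP := Submodule.span_mono (monomials_restrict L (inf_le_left (b := V))) hP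
  replace hQ := Submodule.span_mono (monomials_restrict L (inf_le_right (a := U))) hQ
  refine ⟨U ⊓ V, ⟨hpU, hpV⟩, P * Q, ?_, fun ξ hξ => by simp [hG ξ hξ.1, hH ξ hξ.2]⟩
  have h := Submodule.mul_mem_mul hP hQ
  rw [Submodule.span_mul_span] at h
  refine Submodule.span_mono ?_ h
  rintro _ ⟨P, hP, Q, hQ, rfl⟩
  exact monomials_mul hP hQ

theorem pullback_mem_locPoly {i : ℤ} {U : Opens M} {h : M → ℝ} (hh : h ∈ W.Fil i U) {p : M}
    (hp : p ∈ U) : pullback F A h ∈ locPoly L 0 i p :=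
  ⟨U, hp, _, Submodule.subset_span ⟨h, Fin.elim0, i, Fin.elim0, hh, fun l => l.elim0, by simp,
    by funext ξ; simp [pullback]⟩, fun _ _ => rfl⟩

theorem fibreLinear_mem_locPoly {i : ℤ} {U : Opens M} {σ : ∀ x, A x} (hσ : σ ∈ L.Fil i U) {p : M}
    (hp : p ∈ U) : fibreLinear (F := F) σ ∈ locPoly L 1 i p :=
  ⟨U, hp, _, Submodule.subset_span ⟨fun _ => 1, fun _ => σ, 0, fun _ => i,
    W.nonpos le_rfl contMDiffOn_const, fun _ => hσ, by simp, by funext ξ; simp [fibreLinear]⟩,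
    fun _ _ => rfl⟩

/-- Germs of homogeneous polynomial functions are sums of products of the functions defined by
global functions and sections. -/
theorem locPoly_induction {p : M} {motive : ℕ → ℤ → (DualSpace F A → ℝ) → Prop}
    (congr : ∀ {n i G H}, motive n i G → (∀ᶠ ξ in nearFibre F A p, H ξ = G ξ) → motive n i H)
    (add : ∀ {n i G H}, G ∈ locPoly L n i p → H ∈ locPoly L n i p → motive n i G → motive n i H →
      motive n i (G + H))
    (smul : ∀ {n i G} (c : ℝ), G ∈ locPoly L n i p → motive n i G → motive n i (c • G))
    (base : ∀ {i} (h : Fn m M), ⇑h ∈ W.Fil i ⊤ → motive 0 i (pullback F A h))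
    (step : ∀ {n i j G} (σ : Sec m F A), G ∈ locPoly L n i p → motive n i G → ⇑σ ∈ L.Fil j ⊤ →
      motive (n + 1) (i + j) (G * fibreLinear σ))
    {n : ℕ} {i : ℤ} {G : DualSpace F A → ℝ} (hG : G ∈ locPoly L n i p) : motive n i G := by
  -- Induction on the number of linear factors: the last one is split off and replaced by a global
  -- section with the same germ.
  have mono : ∀ (n : ℕ) (i : ℤ) (U : Opens M), p ∈ U → ∀ P ∈ monomials L n i U, motive n i P := by
    intro n
    induction n with
    | zero =>
      rintro i U hp _ ⟨h, σ, a, b, hh, -, hab, rfl⟩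
      obtain ⟨g, hg, hhg⟩ := W.exists_extension hh hp
      have : a = i := by simpa using hab
      subst this
      refine congr (base g hg) ?_
      filter_upwards [eventually_nearFibre_of_base hhg] with ξ hξ
      simp [pullback, hξ]
    | succ n ih =>
      rintro i U hp _ ⟨h, σ, a, b, hh, hσ, hab, rfl⟩
      obtain ⟨τ, hτ, hστ⟩ := L.exists_extension (hσ (Fin.last n)) hp
      rw [Fin.sum_univ_castSucc, ← add_assoc] at hab
      subst hab
      have hP : (fun ξ : DualSpace F A => h ξ.1 * ∏ l : Fin n, (ξ.2 (σ l.castSucc ξ.1) : ℝ)) ∈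
          monomials L n (a + ∑ l : Fin n, b l.castSucc) U :=
        ⟨h, _, a, _, hh, fun l => hσ l.castSucc, rfl, rfl⟩
      refine congr (step τ ⟨U, hp, _, Submodule.subset_span hP, fun _ _ => rfl⟩
        (ih _ U hp _ hP) hτ) ?_
      filter_upwards [eventually_nearFibre_of_base hστ] with ξ hξ
      simp only [Fin.prod_univ_castSucc, Pi.mul_apply, fibreLinear, hξ]
      ring
  obtain ⟨U, hp, P, hP, hGP⟩ := hG
  have hspan : ∀ P ∈ Submodule.span ℝ (monomials L n i U), P ∈ locPoly L n i p := fun P hP =>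
    ⟨U, hp, P, hP, fun _ _ => rfl⟩
  refine congr ?_ (eventually_nearFibre.2 ⟨U, hp, hGP⟩)
  clear hGP
  induction hP using Submodule.span_induction with
  | mem P hP => exact mono n i U hp P hP
  -- Zero is itself a monomial of every bidegree, so the motive needs no clause for it.
  | zero =>
    exact mono n i U hp 0 ⟨0, fun _ => 0, i, fun _ => 0, zero_mem _, fun _ => zero_mem _, by simp,
      by funext ξ; simp⟩
  | add P Q hP hQ h1 h2 => exact add (hspan P hP) (hspan Q hQ) h1 h2
  | smul c P hP h1 => exact smul c (hspan P hP) h1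

end Germs

section Brackets

variable {W : Weighting m M} {L : LinearWeighting F A W}

/-! ### Recovering the filtrations of functions and sections from that of polynomials -/

/-- This scaling law is what separates the homogeneous components of a polynomial function. -/
theorem locPoly_homogeneous {n : ℕ} {i : ℤ} {p : M} {G : DualSpace F A → ℝ}
    (hG : G ∈ locPoly L n i p) (ξ : A p →L[ℝ] Bundle.Trivial M ℝ p) (t : ℝ) :
    G ⟨p, t • ξ⟩ = t ^ n * G ⟨p, ξ⟩ := by
  refine locPoly_induction (L := L) (p := p)
    (motive := fun n _ G => G ⟨p, t • ξ⟩ = t ^ n * G ⟨p, ξ⟩) ?_ ?_ ?_ ?_ ?_ hG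
  · intro n i G H hG h
    rw [eventually_nearFibre_apply h rfl, eventually_nearFibre_apply h rfl, hG]
  · intro n i G H _ _ hG hH
    simp only [Pi.add_apply, hG, hH]; ring
  · intro n i G c _ hG
    simp only [Pi.smul_apply, hG, smul_eq_mul]; ring
  · intro i h _
    simp [pullback]
  · intro n i j G σ _ hG _
    have : fibreLinear (F := F) σ (⟨p, t • ξ⟩ : DualSpace F A) =
        t * fibreLinear (F := F) σ (⟨p, ξ⟩ : DualSpace F A) := rfl
    simp only [Pi.mul_apply, hG, this]; ring

theorem locPoly_zero {i : ℤ} {p : M} {G : DualSpace F A → ℝ} (hG : G ∈ locPoly L 0 i p) :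
    ∃ h : M → ℝ, h ∈ W.Fil i ⊤ ∧ ∀ᶠ ξ in nearFibre F A p, G ξ = h ξ.1 := by
  obtain ⟨U, hp, P, hP, hGP⟩ := hG
  have : ∃ h : M → ℝ, h ∈ W.Fil i U ∧ P = pullback F A h := by
    clear hGP
    induction hP using Submodule.span_induction with
    | mem P hP =>
      obtain ⟨h, σ, a, b, hh, -, hab, rfl⟩ := hP
      have : a = i := by simpa using hab
      subst this
      exact ⟨h, hh, by funext ξ; simp [pullback]⟩
    | zero => exact ⟨0, zero_mem _, rfl⟩
    | add P Q _ _ h1 h2 =>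
      obtain ⟨h, hh, rfl⟩ := h1
      obtain ⟨h', hh', rfl⟩ := h2
      exact ⟨h + h', add_mem hh hh', rfl⟩
    | smul c P _ h1 =>
      obtain ⟨h, hh, rfl⟩ := h1
      exact ⟨c • h, Submodule.smul_mem _ _ hh, rfl⟩
  obtain ⟨h, hh, rfl⟩ := this
  obtain ⟨g, hg, hgh⟩ := W.exists_extension hh hp
  refine ⟨g, hg, ?_⟩
  filter_upwards [eventually_nearFibre.2 ⟨U, hp, hGP⟩, eventually_nearFibre_of_base hgh] with ξ h1 h2
  rw [h1, ← h2]; rfl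

/-- Since h · f_σ = f_{hσ}, a monomial with one linear factor comes from a single section, whose
degree is given by `LinearWeighting.fil_smul`. -/
theorem locPoly_one {i : ℤ} {p : M} {G : DualSpace F A → ℝ} (hG : G ∈ locPoly L 1 i p) :
    ∃ σ : ∀ x, A x, σ ∈ L.Fil i ⊤ ∧ ∀ᶠ ξ in nearFibre F A p, G ξ = fibreLinear σ ξ := by
  obtain ⟨U, hp, P, hP, hGP⟩ := hG
  have : ∃ σ : ∀ x, A x, σ ∈ L.Fil i U ∧ P = fibreLinear (F := F) σ := by
    clear hGP
    induction hP using Submodule.span_induction with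
    | mem P hP =>
      obtain ⟨h, σ, a, b, hh, hσ, hab, rfl⟩ := hP
      rw [Fin.sum_univ_one] at hab
      subst hab
      refine ⟨_, L.fil_smul hh (hσ 0), ?_⟩
      funext ξ
      rw [Fin.prod_univ_one]
      exact (map_smul ξ.2 _ _).symm
    | zero => exact ⟨0, zero_mem _, by funext ξ; exact (map_zero ξ.2).symm⟩
    | add P Q _ _ h1 h2 =>
      obtain ⟨h, hh, rfl⟩ := h1
      obtain ⟨h', hh', rfl⟩ := h2
      exact ⟨h + h', add_mem hh hh', by funext ξ; exact (map_add ξ.2 _ _).symm⟩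
    | smul c P _ h1 =>
      obtain ⟨h, hh, rfl⟩ := h1
      exact ⟨c • h, Submodule.smul_mem _ _ hh, by funext ξ; exact (map_smul ξ.2 _ _).symm⟩
  obtain ⟨σ, hσ, rfl⟩ := this
  obtain ⟨τ, hτ, hστ⟩ := L.exists_extension hσ hp
  refine ⟨τ, hτ, ?_⟩
  filter_upwards [eventually_nearFibre.2 ⟨U, hp, hGP⟩, eventually_nearFibre_of_base hστ] with ξ h1 h2
  rw [h1, fibreLinear, fibreLinear, h2]

theorem homPoly_subset_polyFn {n : ℕ} {i : ℤ} : homPoly L n i ⊆ polyFn L i := by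
  intro G hG
  refine ⟨n + 1, fun k => if k = n then G else 0, fun k => ?_, ?_⟩
  · dsimp only
    split_ifs with h
    · rw [h]; exact hG
    · exact (mem_homPoly_iff L).2 fun p => zero_mem _
  · simp

/-- A polynomial function of filtration degree `i` which is homogeneous on each fibre lies in the
`i`-th step of the filtration of the homogeneous polynomial functions. -/
theorem mem_homPoly_of_mem_polyFn {n : ℕ} {i : ℤ} {G : DualSpace F A → ℝ} (hG : G ∈ polyFn L i)
    (hhom : ∀ (p : M) (ξ : A p →L[ℝ] Bundle.Trivial M ℝ p) (t : ℝ),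
      G ⟨p, t • ξ⟩ = t ^ n * G ⟨p, ξ⟩) : G ∈ homPoly L n i := by
  obtain ⟨d, g, hg, hGg⟩ := hG
  have key : G = if n < d then g n else 0 := by
    funext ⟨p, ξ⟩
    -- Along the line through ξ both sides are polynomials in t agreeing at every real t. Comparing
    -- coefficients of tⁿ shows that G is its component of degree n, which is zero if n ≥ d.
    have h : (∑ k ∈ Finset.range d, Polynomial.C (g k ⟨p, ξ⟩) * Polynomial.X ^ k : Polynomial ℝ) =
        Polynomial.C (G ⟨p, ξ⟩) * Polynomial.X ^ n := by
      refine Polynomial.funext fun t => ?_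
      simp only [Polynomial.eval_finsetSum, Polynomial.eval_mul, Polynomial.eval_C,
        Polynomial.eval_pow, Polynomial.eval_X]
      rw [mul_comm, ← hhom p ξ t, hGg, Finset.sum_apply]
      refine Finset.sum_congr rfl fun k _ => ?_
      rw [locPoly_homogeneous (hg k p), mul_comm]
    have h2 := congrArg (fun P => Polynomial.coeff P n) h
    simp only [Polynomial.finsetSum_coeff, Polynomial.coeff_C_mul_X_pow, if_true] at h2
    rw [← h2]
    split_ifs with hn
    · simp [hn]
    · simp [hn]
  rw [key]
  split_ifs
  · exact hg n
  · exact (mem_homPoly_iff L).2 fun p => zero_mem _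

theorem mem_fil_of_pullback_mem_polyFn {i : ℤ} {h : M → ℝ} (hh : pullback F A h ∈ polyFn L i) :
    h ∈ W.Fil i ⊤ := by
  have h0 := mem_homPoly_of_mem_polyFn (n := 0) hh fun p ξ t => by simp [pullback]
  refine W.fil_of_eventuallyEq fun p _ => ?_
  obtain ⟨g, hg, hgh⟩ := locPoly_zero (h0 p)
  obtain ⟨U, hp, hU⟩ := eventually_nearFibre.1 hgh
  refine ⟨⊤, g, trivial, hg, ?_⟩
  filter_upwards [U.isOpen.mem_nhds hp] with x hx
  -- Evaluation along the zero section recovers the function on M.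
  exact hU ⟨x, 0⟩ hx

/-- Functionals separate points of the normed model F, and a trivialization carries this over to the
fibre. -/
theorem eq_of_fibreLinear_eq {x : M} {σ τ : ∀ x, A x}
    (h : ∀ ξ : A x →L[ℝ] Bundle.Trivial M ℝ x,
      fibreLinear (F := F) σ ⟨x, ξ⟩ = fibreLinear (F := F) τ ⟨x, ξ⟩) : σ x = τ x := by
  let e := VectorBundle.continuousLinearEquivAt ℝ F A x
  refine e.injective ((SeparatingDual.eq_iff_forall_dual_eq (R := ℝ)).2 fun φ => ?_)
  exact h (φ.comp (e : A x →L[ℝ] F))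

theorem mem_fil_of_fibreLinear_mem_polyFn {i : ℤ} {σ : ∀ x, A x}
    (hh : fibreLinear (F := F) σ ∈ polyFn L i) : σ ∈ L.Fil i ⊤ := by
  have h0 := mem_homPoly_of_mem_polyFn (n := 1) hh fun p ξ t => by rw [pow_one]; rfl
  refine L.fil_of_eventuallyEq fun p _ => ?_
  obtain ⟨g, hg, hgh⟩ := locPoly_one (h0 p)
  obtain ⟨U, hp, hU⟩ := eventually_nearFibre.1 hgh
  refine ⟨⊤, g, trivial, hg, ?_⟩
  filter_upwards [U.isOpen.mem_nhds hp] with x hx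
  exact eq_of_fibreLinear_eq (F := F) fun ξ => hU ⟨x, ξ⟩ hx

/-! ### The Poisson bivector field on generators -/

theorem fibreLinear_eq_affineFn (σ : Sec m F A) :
    fibreLinear (F := F) σ = affineFn σ (0 : Fn m M) := by
  funext ξ
  exact (add_zero _).symm

theorem pullback_eq_affineFn (f : Fn m M) : pullback F A f = affineFn (0 : Sec m F A) f := by
  funext ξ
  have : (ξ.2 ((0 : Sec m F A) ξ.1) : ℝ) = 0 := map_zero ξ.2
  change f ξ.1 = (ξ.2 ((0 : Sec m F A) ξ.1) : ℝ) + f ξ.1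
  rw [this, zero_add]

theorem lieDeriv_zero_fn (x : M) (X : TangentSpace (𝓡 m) x) :
    lieDeriv (0 : Fn m M) x X = 0 := by
  have : mfderiv (𝓡 m) 𝓘(ℝ, ℝ) (fun _ : M => (0 : ℝ)) x = 0 := mfderiv_const
  exact congrArg (fun T : TangentSpace (𝓡 m) x →L[ℝ] ℝ => T X) this

theorem lieDeriv_zero (f : M → ℝ) (x : M) : lieDeriv f x (0 : TangentSpace (𝓡 m) x) = 0 :=
  map_zero (mfderiv (𝓡 m) 𝓘(ℝ, ℝ) f x)

/-- The bracket `π(dG, dH)` of two functions on `A*`. -/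
def pb (𝔸 : LieAlgebroid m F A) (G H : DualSpace F A → ℝ) : DualSpace F A → ℝ :=
  fun ξ => poisson 𝔸 ξ (dDual m G ξ) (dDual m H ξ)

theorem pb_fibreLinear_fibreLinear (𝔸 : LieAlgebroid m F A) (σ τ : Sec m F A) :
    pb 𝔸 (fibreLinear σ) (fibreLinear τ) = fibreLinear (𝔸.bracket σ τ) := by
  funext ξ
  rw [pb, fibreLinear_eq_affineFn, fibreLinear_eq_affineFn, poisson_apply, affineBracket,
    lieDeriv_zero_fn, lieDeriv_zero_fn]
  simp [fibreLinear]

theorem pb_fibreLinear_pullback (𝔸 : LieAlgebroid m F A) (σ : Sec m F A) (g : Fn m M) :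
    pb 𝔸 (fibreLinear σ) (pullback F A g) =
      pullback F A fun x => lieDeriv g x (𝔸.anchor x (σ x)) := by
  funext ξ
  rw [pb, fibreLinear_eq_affineFn, pullback_eq_affineFn, poisson_apply, affineBracket,
    lieDeriv_zero_fn, map_zero]
  have : (ξ.2 ((0 : Sec m F A) ξ.1) : ℝ) = 0 := map_zero ξ.2
  rw [this]
  simp [pullback]

theorem pb_pullback_pullback (𝔸 : LieAlgebroid m F A) (f g : Fn m M) :
    pb 𝔸 (pullback F A f) (pullback F A g) = 0 := by
  funext ξ
  rw [pb, pullback_eq_affineFn, pullback_eq_affineFn, poisson_apply, affineBracket, map_zero]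
  have h1 : (ξ.2 ((0 : Sec m F A) ξ.1) : ℝ) = 0 := map_zero ξ.2
  have h2 : 𝔸.anchor ξ.1 ((0 : Sec m F A) ξ.1) = 0 := map_zero (𝔸.anchor ξ.1)
  rw [h1, h2, lieDeriv_zero, lieDeriv_zero]
  simp

theorem isInfMultiplicative_of_poisson_mem {𝔸 : LieAlgebroid m F A}
    (h : poisson 𝔸 ∈ bivectors L 0) : IsInfMultiplicative 𝔸 L := by
  have hl : ∀ {i : ℤ} {σ : Sec m F A}, ⇑σ ∈ L.Fil i ⊤ → fibreLinear (F := F) σ ∈ polyFn L i :=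
    fun hσ => homPoly_subset_polyFn fun p => fibreLinear_mem_locPoly hσ trivial
  refine ⟨fun i σ hσ => ⟨anchor_section_smooth 𝔸 σ, fun j f hf => ?_⟩, fun i j σ τ hσ hτ => ?_⟩
  · have hf' : pullback F A (W.toFn hf) ∈ polyFn L j :=
      homPoly_subset_polyFn fun p => pullback_mem_locPoly hf trivial
    have h1 : pb 𝔸 _ _ ∈ _ := h i j _ _ (hl hσ) hf'
    rw [pb_fibreLinear_pullback, zero_add] at h1
    exact mem_fil_of_pullback_mem_polyFn h1
  · have h1 : pb 𝔸 _ _ ∈ _ := h i j _ _ (hl hσ) (hl hτ)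
    rw [pb_fibreLinear_fibreLinear, zero_add] at h1
    exact mem_fil_of_fibreLinear_mem_polyFn h1

/-! ### The Poisson bracket is a biderivation -/

variable (m) in
/-- The function `G` is differentiable at `ξ` and its differential there is that of a function which
is affine on the fibres. -/
def IsAffineAt (G : DualSpace F A → ℝ) (ξ : DualSpace F A) : Prop :=
  MDifferentiableAt ((𝓡 m).prod 𝓘(ℝ, F →L[ℝ] ℝ)) 𝓘(ℝ, ℝ) G ξ ∧
    ∃ (σ : Sec m F A) (f : Fn m M), dDual m G ξ = dDual m (affineFn σ f) ξ

theorem isAffineAt_affineFn (σ : Sec m F A) (f : Fn m M) (ξ : DualSpace F A) :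
    IsAffineAt m (affineFn σ f) ξ :=
  ⟨(contMDiff_affineFn σ f).mdifferentiableAt (by simp), σ, f, rfl⟩

/-- The rules for sums, products and multiples are all written as two-term combinations, with
redundant coefficients 1 and 0, to fit `IsAffineAt.of_comb` and `pb_comb`. -/
theorem dDual_add {G H : DualSpace F A → ℝ} {ξ : DualSpace F A} (hG : IsAffineAt m G ξ)
    (hH : IsAffineAt m H ξ) :
    dDual m (G + H) ξ = (1 : ℝ) • dDual m G ξ + (1 : ℝ) • dDual m H ξ := by
  rw [one_smul, one_smul]
  exact mfderiv_add hG.1 hH.1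

theorem dDual_mul {G H : DualSpace F A → ℝ} {ξ : DualSpace F A} (hG : IsAffineAt m G ξ)
    (hH : IsAffineAt m H ξ) :
    dDual m (G * H) ξ = G ξ • dDual m H ξ + H ξ • dDual m G ξ :=
  (hG.1.hasMFDerivAt.mul hH.1.hasMFDerivAt).mfderiv

theorem dDual_smul (c : ℝ) {G : DualSpace F A → ℝ} {ξ : DualSpace F A} (hG : IsAffineAt m G ξ) :
    dDual m (c • G) ξ = c • dDual m G ξ + (0 : ℝ) • dDual m G ξ := by
  rw [zero_smul, add_zero]
  exact const_smul_mfderiv hG.1 c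

theorem dDual_congr {G H : DualSpace F A → ℝ} {ξ : DualSpace F A} (h : G =ᶠ[𝓝 ξ] H) :
    dDual m G ξ = dDual m H ξ := h.mfderiv_eq

theorem affineFn_comb (σ τ : Sec m F A) (f g : Fn m M) (c d : ℝ) :
    affineFn (c • σ + d • τ) (c • f + d • g) = c • affineFn (F := F) σ f + d • affineFn τ g := by
  funext ξ
  have : (ξ.2 ((c • σ + d • τ) ξ.1) : ℝ) = c * (ξ.2 (σ ξ.1) : ℝ) + d * (ξ.2 (τ ξ.1) : ℝ) :=
    (map_add ξ.2 (c • σ ξ.1) (d • τ ξ.1)).trans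
      (congrArg₂ (fun a b : ℝ => a + b) (map_smul ξ.2 c _) (map_smul ξ.2 d _))
  change (ξ.2 ((c • σ + d • τ) ξ.1) : ℝ) + (c * f ξ.1 + d * g ξ.1) =
    c * ((ξ.2 (σ ξ.1) : ℝ) + f ξ.1) + d * ((ξ.2 (τ ξ.1) : ℝ) + g ξ.1)
  rw [this]
  ring

theorem dDual_affineFn_comb (σ τ : Sec m F A) (f g : Fn m M) (c d : ℝ) (ξ : DualSpace F A) :
    dDual m (affineFn (c • σ + d • τ) (c • f + d • g)) ξ =
      c • dDual m (affineFn σ f) ξ + d • dDual m (affineFn τ g) ξ := by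
  have h1 := isAffineAt_affineFn σ f ξ
  have h2 := isAffineAt_affineFn τ g ξ
  rw [affineFn_comb]
  refine (mfderiv_add (h1.1.const_smul c) (h2.1.const_smul d)).trans ?_
  exact congrArg₂ (· + ·) (const_smul_mfderiv h1.1 c) (const_smul_mfderiv h2.1 d)

theorem affineBracket_smul (𝔸 : LieAlgebroid m F A) (ξ : DualSpace F A) (c : ℝ)
    (σ τ : Sec m F A) (f g : Fn m M) :
    affineBracket 𝔸 ξ (c • σ) (c • f) τ g = c * affineBracket 𝔸 ξ σ f τ g := by
  have h1 : (ξ.2 (𝔸.bracket (c • σ) τ ξ.1) : ℝ) = c * (ξ.2 (𝔸.bracket σ τ ξ.1) : ℝ) := by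
    rw [map_smul]; exact map_smul ξ.2 _ _
  have h2 : lieDeriv g ξ.1 (𝔸.anchor ξ.1 ((c • σ) ξ.1)) =
      c * lieDeriv g ξ.1 (𝔸.anchor ξ.1 (σ ξ.1)) := by
    have e : 𝔸.anchor ξ.1 ((c • σ) ξ.1) = c • 𝔸.anchor ξ.1 (σ ξ.1) :=
      map_smul (𝔸.anchor ξ.1) _ _
    rw [e]
    exact map_smul (mfderiv (𝓡 m) 𝓘(ℝ, ℝ) g ξ.1) _ _
  have h3 : lieDeriv (c • f) ξ.1 (𝔸.anchor ξ.1 (τ ξ.1)) =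
      c * lieDeriv f ξ.1 (𝔸.anchor ξ.1 (τ ξ.1)) :=
    lieDeriv_const_mul c (fn_mdiff f ξ.1) _
  unfold affineBracket
  rw [h1, h2]
  erw [h3]
  ring

theorem affineBracket_comb (𝔸 : LieAlgebroid m F A) (ξ : DualSpace F A) (c d : ℝ)
    (σ σ' τ : Sec m F A) (f f' g : Fn m M) :
    affineBracket 𝔸 ξ (c • σ + d • σ') (c • f + d • f') τ g =
      c * affineBracket 𝔸 ξ σ f τ g + d * affineBracket 𝔸 ξ σ' f' τ g := by
  -- Additivity is read off from subtractivity: the sum minus its second summand is the first.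
  have := affineBracket_sub 𝔸 ξ (c • σ + d • σ') (d • σ') τ (c • f + d • f') (d • f') g
  rw [add_sub_cancel_right, add_sub_cancel_right, affineBracket_smul, affineBracket_smul] at this
  linarith

/-- The differentials at ξ of the functions f_σ + p^*f form a linear space, so sums and products
stay where `poisson_apply` computes π. -/
theorem IsAffineAt.of_comb {G H K : DualSpace F A → ℝ} {ξ : DualSpace F A}
    (hK : MDifferentiableAt ((𝓡 m).prod 𝓘(ℝ, F →L[ℝ] ℝ)) 𝓘(ℝ, ℝ) K ξ)
    (hG : IsAffineAt m G ξ) (hH : IsAffineAt m H ξ) {c d : ℝ}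
    (h : dDual m K ξ = c • dDual m G ξ + d • dDual m H ξ) : IsAffineAt m K ξ := by
  obtain ⟨-, σ, f, h1⟩ := hG
  obtain ⟨-, τ, g, h2⟩ := hH
  exact ⟨hK, c • σ + d • τ, c • f + d • g, by rw [dDual_affineFn_comb, h, h1, h2]⟩

theorem IsAffineAt.add {G H : DualSpace F A → ℝ} {ξ : DualSpace F A} (hG : IsAffineAt m G ξ)
    (hH : IsAffineAt m H ξ) : IsAffineAt m (G + H) ξ :=
  IsAffineAt.of_comb (hG.1.add hH.1) hG hH (dDual_add hG hH)

theorem IsAffineAt.mul {G H : DualSpace F A → ℝ} {ξ : DualSpace F A} (hG : IsAffineAt m G ξ)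
    (hH : IsAffineAt m H ξ) : IsAffineAt m (G * H) ξ :=
  IsAffineAt.of_comb (hG.1.mul hH.1) hH hG (dDual_mul hG hH)

theorem IsAffineAt.const_smul (c : ℝ) {G : DualSpace F A → ℝ} {ξ : DualSpace F A}
    (hG : IsAffineAt m G ξ) : IsAffineAt m (c • G) ξ :=
  IsAffineAt.of_comb (hG.1.const_smul c) hG hG (dDual_smul c hG)

theorem IsAffineAt.congr {G H : DualSpace F A → ℝ} {ξ : DualSpace F A} (hG : IsAffineAt m G ξ)
    (h : H =ᶠ[𝓝 ξ] G) : IsAffineAt m H ξ :=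
  ⟨hG.1.congr_of_eventuallyEq h, by rw [dDual_congr h]; exact hG.2⟩

/-- Stated for any K with the given differential at one point, this contains both additivity and the
Leibniz rule; in the latter c and d are values at ξ. -/
theorem pb_comb (𝔸 : LieAlgebroid m F A) {G G' H K : DualSpace F A → ℝ} {ξ : DualSpace F A}
    (hG : IsAffineAt m G ξ) (hG' : IsAffineAt m G' ξ) (hH : IsAffineAt m H ξ) {c d : ℝ}
    (h : dDual m K ξ = c • dDual m G ξ + d • dDual m G' ξ) :
    pb 𝔸 K H ξ = c * pb 𝔸 G H ξ + d * pb 𝔸 G' H ξ := by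
  obtain ⟨-, σ, f, h1⟩ := hG
  obtain ⟨-, σ', f', h2⟩ := hG'
  obtain ⟨-, τ, g, h3⟩ := hH
  rw [pb, pb, pb, h, h1, h2, h3, ← dDual_affineFn_comb, poisson_apply, poisson_apply,
    poisson_apply, affineBracket_comb]

theorem pb_skew (𝔸 : LieAlgebroid m F A) {G H : DualSpace F A → ℝ} {ξ : DualSpace F A}
    (hG : IsAffineAt m G ξ) (hH : IsAffineAt m H ξ) : pb 𝔸 G H ξ = - pb 𝔸 H G ξ := by
  obtain ⟨-, σ, f, h1⟩ := hG
  obtain ⟨-, τ, g, h3⟩ := hH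
  rw [pb, pb, h1, h3, poisson_apply, poisson_apply, affineBracket_skew]

theorem pb_add (𝔸 : LieAlgebroid m F A) {G G' H : DualSpace F A → ℝ} {ξ : DualSpace F A}
    (hG : IsAffineAt m G ξ) (hG' : IsAffineAt m G' ξ) (hH : IsAffineAt m H ξ) :
    pb 𝔸 (G + G') H ξ = pb 𝔸 G H ξ + pb 𝔸 G' H ξ := by
  rw [pb_comb 𝔸 hG hG' hH (dDual_add hG hG'), one_mul, one_mul]

theorem isAffineAt_fibreLinear (σ : Sec m F A) (ξ : DualSpace F A) :
    IsAffineAt m (fibreLinear σ) ξ := by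
  rw [fibreLinear_eq_affineFn]; exact isAffineAt_affineFn _ _ _

theorem isAffineAt_pullback (f : Fn m M) (ξ : DualSpace F A) :
    IsAffineAt m (pullback F A f) ξ := by
  rw [pullback_eq_affineFn]; exact isAffineAt_affineFn _ _ _

theorem isAffineAt_of_mem_locPoly {n : ℕ} {i : ℤ} {p : M} {G : DualSpace F A → ℝ}
    (hG : G ∈ locPoly L n i p) : ∀ᶠ ξ in nearFibre F A p, IsAffineAt m G ξ := by
  refine locPoly_induction (L := L) (p := p)
    (motive := fun _ _ G => ∀ᶠ ξ in nearFibre F A p, IsAffineAt m G ξ) ?_ ?_ ?_ ?_ ?_ hG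
  · intro n i G H hG h
    filter_upwards [hG, eventually_eventually_nearFibre h] with ξ h1 h2 using h1.congr h2
  · intro n i G H _ _ hG hH
    filter_upwards [hG, hH] with ξ h1 h2 using h1.add h2
  · intro n i G c _ hG
    filter_upwards [hG] with ξ h1 using h1.const_smul c
  · intro i h _
    exact Filter.Eventually.of_forall fun ξ => isAffineAt_pullback h ξ
  · intro n i j G σ _ hG _
    filter_upwards [hG] with ξ h1 using h1.mul (isAffineAt_fibreLinear σ ξ)

/-! ### The bracket of polynomial functions -/

variable (L) in
/-- The germs of functions that brackets of homogeneous polynomial functions with degrees of sum `n`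
are to lie in: homogeneous polynomial functions of degree `n - 1`, or zero. -/
def bracketPoly : ℕ → ℤ → M → Submodule ℝ (DualSpace F A → ℝ)
  | 0, _, p =>
    { carrier := {G | ∀ᶠ ξ in nearFibre F A p, G ξ = 0}
      zero_mem' := by
        change ∀ᶠ ξ in nearFibre F A p, (0 : DualSpace F A → ℝ) ξ = 0
        exact Filter.Eventually.of_forall fun _ => rfl
      add_mem' := fun {G H} hG hH => by
        change ∀ᶠ ξ in nearFibre F A p, (G + H) ξ = 0
        filter_upwards [hG, hH] with ξ h1 h2
        simp [h1, h2]
      smul_mem' := fun c G hG => by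
        change ∀ᶠ ξ in nearFibre F A p, (c • G) ξ = 0
        filter_upwards [hG] with ξ h1
        simp [h1] }
  | n + 1, i, p => locPoly L n i p

theorem bracketPoly_congr {n : ℕ} {i : ℤ} {p : M} {G H : DualSpace F A → ℝ}
    (hG : G ∈ bracketPoly L n i p) (h : ∀ᶠ ξ in nearFibre F A p, H ξ = G ξ) :
    H ∈ bracketPoly L n i p := by
  cases n with
  | zero =>
    filter_upwards [hG, h] with ξ h1 h2
    exact h2.trans h1
  | succ n => exact locPoly_congr hG h

theorem bracketPoly_mul {n k : ℕ} {i j : ℤ} {p : M} {G H : DualSpace F A → ℝ}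
    (hG : G ∈ locPoly L n i p) (hH : H ∈ bracketPoly L k j p) :
    G * H ∈ bracketPoly L (n + k) (i + j) p := by
  cases k with
  | zero =>
    refine bracketPoly_congr (zero_mem _) ?_
    filter_upwards [hH] with ξ h
    simp [h]
  | succ k => exact locPoly_mul hG hH

/-- For fixed H the bracket with H is a derivation, so its degrees are controlled by its values on
generators. It serves once for each slot. -/
theorem pb_mem_of_generators (𝔸 : LieAlgebroid m F A) {p : M} {k : ℕ} {j : ℤ}
    {H : DualSpace F A → ℝ} (hH : ∀ᶠ ξ in nearFibre F A p, IsAffineAt m H ξ)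
    (hbase : ∀ {i : ℤ} (h : Fn m M), ⇑h ∈ W.Fil i ⊤ →
      pb 𝔸 (pullback F A h) H ∈ bracketPoly L (0 + k) (i + j) p)
    (hlin : ∀ {i : ℤ} (σ : Sec m F A), ⇑σ ∈ L.Fil i ⊤ →
      pb 𝔸 (fibreLinear σ) H ∈ bracketPoly L (1 + k) (i + j) p)
    {n : ℕ} {i : ℤ} {G : DualSpace F A → ℝ} (hG : G ∈ locPoly L n i p) :
    pb 𝔸 G H ∈ bracketPoly L (n + k) (i + j) p := by
  refine locPoly_induction (L := L) (p := p)
    (motive := fun n i G => pb 𝔸 G H ∈ bracketPoly L (n + k) (i + j) p) ?_ ?_ ?_ hbase ?_ hG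
  · intro n i G K hG h
    refine bracketPoly_congr hG ?_
    filter_upwards [eventually_eventually_nearFibre h] with ξ h1
    rw [pb, pb, dDual_congr h1]
  · intro n i G K hG hK h1 h2
    refine bracketPoly_congr (add_mem h1 h2) ?_
    filter_upwards [isAffineAt_of_mem_locPoly hG, isAffineAt_of_mem_locPoly hK, hH] with ξ g1 g2 g3
    exact pb_add 𝔸 g1 g2 g3
  · intro n i G c hG h1
    refine bracketPoly_congr (Submodule.smul_mem _ c h1) ?_
    filter_upwards [isAffineAt_of_mem_locPoly hG, hH] with ξ g1 g3
    rw [pb_comb 𝔸 g1 g1 g3 (dDual_smul c g1), zero_mul, add_zero]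
    rfl
  · intro n i l G σ hG h1 hσ
    -- The two terms of {G f_σ, H} = G {f_σ, H} + f_σ {G, H}.
    have t1 := bracketPoly_mul hG (hlin σ hσ)
    have t2 := bracketPoly_mul (fibreLinear_mem_locPoly hσ (p := p) trivial) h1
    rw [show n + (1 + k) = n + 1 + k by ring, show i + (l + j) = i + l + j by ring] at t1
    rw [show 1 + (n + k) = n + 1 + k by ring, show l + (i + j) = i + l + j by ring] at t2
    refine bracketPoly_congr (add_mem t1 t2) ?_
    filter_upwards [isAffineAt_of_mem_locPoly hG, hH] with ξ g1 g3
    exact pb_comb 𝔸 (isAffineAt_fibreLinear σ ξ) g1 g3 (dDual_mul g1 (isAffineAt_fibreLinear σ ξ))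

/-- The outer reduction makes G a generator; skew-symmetry then moves H to the first slot, where a
second reduction makes it a generator too. -/
theorem pb_mem_bracketPoly {𝔸 : LieAlgebroid m F A} (h𝔸 : IsInfMultiplicative 𝔸 L) {p : M}
    {n k : ℕ} {i j : ℤ} {G H : DualSpace F A → ℝ} (hG : G ∈ locPoly L n i p)
    (hH : H ∈ locPoly L k j p) : pb 𝔸 G H ∈ bracketPoly L (n + k) (i + j) p := by
  have hlp : ∀ {i j : ℤ} (σ : Sec m F A) (h : Fn m M), ⇑σ ∈ L.Fil i ⊤ → ⇑h ∈ W.Fil j ⊤ →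
      pb 𝔸 (fibreLinear σ) (pullback F A h) ∈ bracketPoly L 1 (i + j) p := by
    intro i j σ h hσ hh
    rw [pb_fibreLinear_pullback]
    exact pullback_mem_locPoly ((h𝔸.1 i σ hσ).2 j h hh) trivial
  have hll : ∀ {i j : ℤ} (σ τ : Sec m F A), ⇑σ ∈ L.Fil i ⊤ → ⇑τ ∈ L.Fil j ⊤ →
      pb 𝔸 (fibreLinear σ) (fibreLinear τ) ∈ bracketPoly L 2 (i + j) p := by
    intro i j σ τ hσ hτ
    rw [pb_fibreLinear_fibreLinear]
    exact fibreLinear_mem_locPoly (h𝔸.2 i j σ τ hσ hτ) trivial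
  have hHa := isAffineAt_of_mem_locPoly hH
  refine pb_mem_of_generators 𝔸 hHa (fun {i} h hh => ?_) (fun {i} σ hσ => ?_) hG
  · have ha := isAffineAt_pullback (F := F) (A := A) h
    have := pb_mem_of_generators 𝔸 (k := 0) (j := i) (Filter.Eventually.of_forall ha)
      (fun f _ => by rw [pb_pullback_pullback]; exact zero_mem _)
      (fun σ hσ => hlp σ h hσ hh) hH
    rw [add_zero, add_comm j i, ← zero_add k] at this
    refine bracketPoly_congr (neg_mem this) ?_
    filter_upwards [hHa] with ξ h1
    exact pb_skew 𝔸 (ha ξ) h1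
  · have ha := isAffineAt_fibreLinear (F := F) σ
    have := pb_mem_of_generators 𝔸 (k := 1) (j := i) (Filter.Eventually.of_forall ha)
      (fun {l} f hf => by
        rw [zero_add, add_comm l i]
        refine bracketPoly_congr (neg_mem (hlp σ f hσ hf)) (Filter.Eventually.of_forall fun ξ => ?_)
        exact pb_skew 𝔸 (isAffineAt_pullback f ξ) (ha ξ))
      (fun τ hτ => hll τ σ hτ hσ) hH
    rw [add_comm k 1, add_comm j i] at this
    refine bracketPoly_congr (neg_mem this) ?_
    filter_upwards [hHa] with ξ h1
    exact pb_skew 𝔸 (ha ξ) h1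

/-! ### Sums of homogeneous components -/

theorem polyFn_zero {i : ℤ} : (0 : DualSpace F A → ℝ) ∈ polyFn L i :=
  homPoly_subset_polyFn (n := 0) fun p => zero_mem (locPoly L 0 i p)

theorem polyFn_add {i : ℤ} {G H : DualSpace F A → ℝ} (hG : G ∈ polyFn L i)
    (hH : H ∈ polyFn L i) : G + H ∈ polyFn L i := by
  obtain ⟨d, g, hg, rfl⟩ := hG
  obtain ⟨e, h, hh, rfl⟩ := hH
  -- Both families are padded with zeros to a common length and added degree by degree.
  have key : ∀ (d N : ℕ) (g : ℕ → DualSpace F A → ℝ), d ≤ N →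
      ∑ n ∈ Finset.range d, g n = ∑ n ∈ Finset.range N, if n < d then g n else 0 := by
    intro d N g hdN
    rw [← Finset.sum_filter]
    congr 1
    ext n
    simp only [Finset.mem_range, Finset.mem_filter]
    omega
  have mem : ∀ (d : ℕ) (g : ℕ → DualSpace F A → ℝ), (∀ n, g n ∈ homPoly L n i) → ∀ n p,
      (if n < d then g n else 0) ∈ locPoly L n i p := by
    intro d g hg n p
    split_ifs
    · exact hg n p
    · exact zero_mem _
  refine ⟨max d e, _, fun n p => add_mem (mem d g hg n p) (mem e h hh n p), ?_⟩
  rw [key d _ g (le_max_left d e), key e _ h (le_max_right d e), Finset.sum_add_distrib]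

theorem polyFn_sum {ι : Type*} {i : ℤ} (s : Finset ι) (G : ι → DualSpace F A → ℝ)
    (hG : ∀ k ∈ s, G k ∈ polyFn L i) : ∑ k ∈ s, G k ∈ polyFn L i :=
  Finset.sum_induction G (· ∈ polyFn L i) (fun _ _ => polyFn_add) polyFn_zero hG

theorem isAffineAt_sum (s : Finset ℕ) (g : ℕ → DualSpace F A → ℝ) (ξ : DualSpace F A)
    (hg : ∀ n, IsAffineAt m (g n) ξ) : IsAffineAt m (∑ n ∈ s, g n) ξ := by
  refine Finset.sum_induction g (fun G => IsAffineAt m G ξ) (fun _ _ => IsAffineAt.add) ?_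
    fun n _ => hg n
  exact isAffineAt_pullback (0 : Fn m M) ξ

theorem pb_sum (𝔸 : LieAlgebroid m F A) (s : Finset ℕ) (g : ℕ → DualSpace F A → ℝ)
    {H : DualSpace F A → ℝ} {ξ : DualSpace F A} (hg : ∀ n, IsAffineAt m (g n) ξ)
    (hH : IsAffineAt m H ξ) : pb 𝔸 (∑ n ∈ s, g n) H ξ = ∑ n ∈ s, pb 𝔸 (g n) H ξ := by
  classical
  induction s using Finset.induction_on with
  | empty =>
    -- The bracket of 0 with H vanishes by additivity applied to 0 + 0.
    have h0 : IsAffineAt m (0 : DualSpace F A → ℝ) ξ := isAffineAt_pullback (0 : Fn m M) ξ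
    have := pb_add 𝔸 h0 h0 hH
    rw [add_zero] at this
    simpa using this
  | insert a s ha ih =>
    rw [Finset.sum_insert ha, Finset.sum_insert ha,
      pb_add 𝔸 (hg a) (isAffineAt_sum s g ξ hg) hH, ih]

theorem IsInfMultiplicative.poisson_mem {𝔸 : LieAlgebroid m F A}
    (h : IsInfMultiplicative 𝔸 L) : poisson 𝔸 ∈ bivectors L 0 := by
  rintro i j _ _ ⟨d, g, hg, rfl⟩ ⟨e, k, hk, rfl⟩
  change pb 𝔸 _ _ ∈ _
  have hga : ∀ n ξ, IsAffineAt m (g n) ξ := fun n ξ =>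
    eventually_nearFibre_apply (isAffineAt_of_mem_locPoly (hg n ξ.1)) rfl
  have hka : ∀ n ξ, IsAffineAt m (k n) ξ := fun n ξ =>
    eventually_nearFibre_apply (isAffineAt_of_mem_locPoly (hk n ξ.1)) rfl
  have e1 : pb 𝔸 (∑ n ∈ Finset.range d, g n) (∑ n ∈ Finset.range e, k n) =
      ∑ n ∈ Finset.range d, ∑ l ∈ Finset.range e, pb 𝔸 (g n) (k l) := by
    funext ξ
    rw [pb_sum 𝔸 _ g (fun n => hga n ξ) (isAffineAt_sum _ k ξ fun n => hka n ξ)]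
    simp only [Finset.sum_apply]
    refine Finset.sum_congr rfl fun n _ => ?_
    rw [pb_skew 𝔸 (hga n ξ) (isAffineAt_sum _ k ξ fun n => hka n ξ),
      pb_sum 𝔸 _ k (fun n => hka n ξ) (hga n ξ), ← Finset.sum_neg_distrib]
    exact Finset.sum_congr rfl fun l _ => (pb_skew 𝔸 (hga n ξ) (hka l ξ)).symm
  rw [e1, zero_add]
  refine polyFn_sum _ _ fun n _ => polyFn_sum _ _ fun l _ => ?_
  have hmem := fun p => pb_mem_bracketPoly h (hg n p) (hk l p)
  -- Brackets lower the fibre degree by one; in total degree 0 both functions are pulled back from M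
  -- and the bracket is zero.
  cases hN : n + l with
  | zero =>
    rw [hN] at hmem
    have : pb 𝔸 (g n) (k l) = 0 := by
      funext ξ
      exact eventually_nearFibre_apply (hmem ξ.1) rfl
    rw [this]
    exact polyFn_zero
  | succ N =>
    rw [hN] at hmem
    exact homPoly_subset_polyFn (n := N) hmem

end Brackets

end WLA

end

theorem mainTheorem8 {m : ℕ} {M : Type*} [TopologicalSpace M]
    [ChartedSpace (EuclideanSpace ℝ (Fin m)) M] [IsManifold (𝓡 m) ∞ M]
    [T2Space M] [SecondCountableTopology M]
    {F : Type*} [NormedAddCommGroup F] [NormedSpace ℝ F] [FiniteDimensional ℝ F]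
    {A : M → Type*} [TopologicalSpace (TotalSpace F A)] [∀ x, AddCommGroup (A x)]
    [∀ x, Module ℝ (A x)] [∀ x, TopologicalSpace (A x)] [FiberBundle F A] [VectorBundle ℝ F A]
    [ContMDiffVectorBundle ∞ F A (𝓡 m)]
    (W : WLA.Weighting m M) (𝔸 : WLA.LieAlgebroid m F A) (L : WLA.LinearWeighting F A W) :
    List.TFAE [
      WLA.IsInfMultiplicative 𝔸 L,
      WLA.poisson 𝔸 ∈ WLA.bivectors L 0,
      WLA.DifferentialPreservesFiltration 𝔸 L] := by
  tfae_have 1 → 2 := fun h => h.poisson_mem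
  tfae_have 2 → 1 := WLA.isInfMultiplicative_of_poisson_mem
  tfae_have 1 → 3 := fun h => h.differentialPreservesFiltration
  tfae_have 3 → 1 := fun h => h.isInfMultiplicative
  tfae_finish
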